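/- **Setting.** Let $k\ge 1$ and $m,p\ge 0$ be integers, let $\mathbb S^k=\{\gamma\in\mathbf R^k:\|\gamma\|=1\}$ (Euclidean norm), and let $\mathbb D=\prod_{j=1}^m\ell^\infty(\mathbb S^k)$, viewed as the space of bounded maps $h:\mathbb S^k\to\mathbf R^m$ with norm $\sup_\gamma\|h(\gamma)\|$. For $\theta\in\mathbb D$ put $\phi(\theta)=\inf_{\gamma\in\mathbb S^k}\|\theta(\gamma)\|^2$. Let $\{Y_t\}$, $\{Z_t\}$ and $\{\sigma_t^2\}$, with $\sigma_t^2=(\sigma_{1t}^2,\dots,\sigma_{pt}^2)^\intercal$, be processes with values in $\mathbf R^k$, $\mathbf R^m$ and $\mathbf R^p$ on a probability space $(\Omega,P)$, adapted to a filtration $\{\mathcal F_t\}$. **Model.** Assume that $\mathrm{Var}(Y_{t+1}|\mathcal F_t)=\Lambda D_t\Lambda^\intercal+\Omega_0$ almost surely, where $D_t=\mathrm{diag}(\sigma_t^2)$, $\Lambda$ is a $k\times p$ matrix of full column rank $p$ and $\Omega_0$ is positive semidefinite. Assume further that $\mathrm{Var}(\sigma_t^2)$ and $\mathrm{Var}(Z_t)$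 are nonsingular; $E[Y_{t+1}|\mathcal F_t]=0$; $\mathrm{Cov}(Z_t,\sigma_t^2)$ has full column rank $p$; $\{(Y_t,Z_t)\}$ is strictly stationary and ergodic; $E\|Z_t\|^2<\infty$ and $E\|Y_t\|^4<\infty$. Let $$c(\gamma)=E[(\gamma^\intercal Y_{t+1})^2],\qquad \theta_0(\gamma)=E[Z_t\{(\gamma^\intercal Y_{t+1})^2-c(\gamma)\}],\qquad \Gamma_0=\{\gamma\in\mathbb S^k:\theta_0(\gamma)=0\},$$ and let $G$ be the $m\times k^2$ matrix with $j$th row $\mathrm{vec}(\Delta_j)^\intercal$, where $\Delta_j=E[Z_t^{(j)}(Y_{t+1}Y_{t+1}^\intercal-E[Y_{t+1}Y_{t+1}^\intercal])]$. **Central limit theorem.** Assume that the stacked vectors $X_t=(Z_t,\ \mathrm{vec}(Y_{t+1}Y_{t+1}^\intercal),\ \mathrm{vec}(Y_{t+1}Y_{t+1}^\intercal)\otimes Z_t)$ fulfill a CLT: $\sqrt T\{T^{-1}\sum_t X_t-E[X_t]\}$ (sum over $T$ consecutive dates) converges in distribution to a centered Gaussian vector $\xi=(\xi^{Z},\xi^{Y},\xi^{YZ})$,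 possibly degenerate. Let $\mathbb G$ be the centered Gaussian process on $\mathbb S^k$ with coordinates $$\mathbb G^{(j)}(\gamma)=\sum_{a,b}\gamma_a\gamma_b\{\xi^{YZ}_{ab,j}-E[Z_t^{(j)}]\,\xi^Y_{ab}\}-c(\gamma)\,\xi^Z_j ,\qquad j=1,\dots,m,$$ that is, the weak limit in $\mathbb D$ of $\sqrt T\{\hat\theta_T-\theta_0\}$ for the estimator $\hat\theta_T$ defined next. **Estimators.** From the data $\{(Z_t,Y_{t+1})\}_{t=1}^T$ put $$\hat c(\gamma)=\tfrac1T\sum_{t=1}^T(\gamma^\intercal Y_{t+1})^2,\qquad \hat\theta_T(\gamma)=\tfrac1T\sum_{t=1}^TZ_t\{(\gamma^\intercal Y_{t+1})^2-\hat c(\gamma)\},$$ and let $\hat G$ be the $m\times k^2$ matrix with $j$th row $\mathrm{vec}(\hat\Delta_j)^\intercal$, where $\hat\Delta_j=\frac1T\sum_tZ_t^{(j)}Y_{t+1}Y_{t+1}^\intercal-\frac1T\sum_tZ_t^{(j)}\,\frac1T\sum_tY_{t+1}Y_{t+1}^\intercal$. Let $\kappa_T$ be constants such that $\kappa_T\downarrow0$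 (that is, $\kappa_T\to 0$ and $\kappa_T>0$ for all large $T$) and $\sqrt T\,\kappa_T\to\infty$. Put $\hat\Gamma_T=\{\gamma\in\mathbb S^k:\|\hat\theta_T(\gamma)\|^2-\phi(\hat\theta_T)\le\kappa_T^2\}$, $B_T=\{v\in\mathbf R^k:\|v\|\le\kappa_T^{-1/2}\}$, and define the structural derivative estimator $$\hat\phi_T''(h)=\inf_{\gamma\in\hat\Gamma_T}\ \min_{v\in B_T}\|h(\gamma)+\hat G\,\mathrm{vec}(vv^\intercal)\|^2,\qquad h\in\mathbb D .$$ **Bootstrap.** Let the bootstrap weights be governed by a probability space $(\mathscr W,Q)$, independent of the data (the joint law being $P\otimes Q$). For each $T$ let the bootstrap sample $\{(Z_t^*,Y_{t+1}^*)\}_{t=1}^T$ be a function of the data $\{(Z_t,Y_{t+1})\}_{t=1}^T$ and of the weights, and let $\hat\theta_T^*$ be $\hat\theta_T$ computed from the bootstrap sample. Write $P_W,E_W$ for probability and expectation over the weights, holding the data fixed, and read probabilities of possibly nonmeasurable events as outer probabilities. Let $\mathrm{BL}_1(\mathbb D)$ be the set of $f:\mathbb D\to\mathbf R$ with $\sup_h|f(h)|+\sup_{h\ne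 h'}|f(h)-f(h')|/\|h-h'\|\le1$. Assume: * $\sup_{f\in\mathrm{BL}_1(\mathbb D)}\big|E_W[f(\sqrt T\{\hat\theta_T^*-\hat\theta_T\})]-E[f(\mathbb G)]\big|\to 0$ in (outer) probability; * for every $f\in\mathrm{BL}_1(\mathbb D)$, the expectation of the minimal measurable majorant of $f(\sqrt T\{\hat\theta_T^*-\hat\theta_T\})$ minus that of its maximal measurable minorant (with respect to data and weights jointly) tends to $0$; * for every continuous bounded $f:\mathbb D\to\mathbf R$ and every $T$, $f(\sqrt T\{\hat\theta_T^*-\hat\theta_T\})$ is a measurable function of the weights, for almost all data. For $\alpha\in(0,1)$ define the critical value $$\hat c_{1-\alpha}=\inf\{c\in\mathbf R:P_W(\hat\phi_T''(\sqrt T\{\hat\theta_T^*-\hat\theta_T\})\le c)\ge1-\alpha\}.$$ **Proposition.** Suppose in addition that the cdf $H$ of $$\min_{\gamma_0\in\Gamma_0}\ \min_{v\in\mathbf R^k}\|\mathbb G(\gamma_0)+G\,\mathrm{vec}(vv^\intercal)\|^2$$ is continuous and strictly increasing at its $1-\alpha$ quantile $c_{1-\alpha}=\inf\{c:H(c)\ge1-\alpha\}$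 (strictly increasing at $c_{1-\alpha}$ means $H(x)<H(c_{1-\alpha})<H(y)$ whenever $x<c_{1-\alpha}<y$). Then, under $\mathrm H_0:\phi(\theta_0)=0$, $$\lim_{T\to\infty}P\Big(T\min_{\gamma\in\mathbb S^k}\|\hat\theta_T(\gamma)\|^2>\hat c_{1-\alpha}\Big)=\alpha .$$ -/

import Mathlib

open MeasureTheory ProbabilityTheory Filter Topology
open scoped ENNReal Matrix

noncomputable section

namespace CommonCH

/-! ### Parameter space and function space -/

/-- `ℝⁿ` with its Euclidean norm. -/
abbrev Vec (n : ℕ) : Type := EuclideanSpace ℝ (Fin n)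

/-- The unit sphere of `ℝᵏ`, as a type. -/
abbrev Sph (k : ℕ) : Type := Metric.sphere (0 : Vec k) 1

/-- The product of `m` copies of `ℓ^∞` of the unit sphere: all bounded maps from the unit sphere
of `ℝᵏ` to `ℝᵐ` (no continuity or measurability is imposed), with norm `sup_γ ‖h γ‖`. -/
abbrev Dspace (k m : ℕ) : Type := lp (fun _ : Sph k => Vec m) ∞

/-- Continuous maps on the sphere are bounded. -/
theorem memlp_of_continuous {k m : ℕ} {h : Sph k → Vec m} (hh : Continuous h) : Memℓp h ∞ := by
  apply memℓp_infty
  have hc : IsCompact (Set.range fun γ : Sph k => ‖h γ‖) := isCompact_range hh.norm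
  exact hc.bddAbove

/-- The functional `φ(θ) = inf_{γ} ‖θ(γ)‖²` over the unit sphere. -/
def phi {k m : ℕ} (θ : Sph k → Vec m) : ℝ := ⨅ γ : Sph k, ‖θ γ‖ ^ 2

/-- The vector `A vec(v vᵀ)` of `ℝᵐ`, for an `m × k²` matrix `A`. -/
def applyVec {k m : ℕ} (A : Matrix (Fin m) (Fin k × Fin k) ℝ) (v : Vec k) : Vec m :=
  WithLp.toLp 2 (A *ᵥ Matrix.vec (Matrix.vecMulVec (v : Fin k → ℝ) (v : Fin k → ℝ)))

/-! ### Sample quantities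

A sample of size `T` is a family `x` of `T` pairs; its pair with index `t` is `(Z_t, Y_{t+1})`. -/

/-- A sample of size `T`. -/
abbrev Sample (k m T : ℕ) : Type := Fin T → Vec m × Vec k

/-- `ĉ(γ) = T⁻¹ ∑_t (γᵀ Y_{t+1})²`. -/
def cHat {k m T : ℕ} (x : Sample k m T) (γ : Vec k) : ℝ :=
  (T : ℝ)⁻¹ * ∑ t, (inner ℝ γ (x t).2) ^ 2

/-- `θ̂(γ) = T⁻¹ ∑_t Z_t {(γᵀ Y_{t+1})² - ĉ(γ)}`. -/
def thetaHat {k m T : ℕ} (x : Sample k m T) (γ : Sph k) : Vec m :=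
  (T : ℝ)⁻¹ • ∑ t, ((inner ℝ (γ : Vec k) (x t).2) ^ 2 - cHat x γ) • (x t).1

theorem continuous_thetaHat {k m T : ℕ} (x : Sample k m T) : Continuous (thetaHat x) := by
  unfold thetaHat cHat
  fun_prop

/-- `θ̂` as an element of the function space. -/
def thetaHatD {k m T : ℕ} (x : Sample k m T) : Dspace k m :=
  ⟨thetaHat x, memlp_of_continuous (continuous_thetaHat x)⟩

/-- `Δ̂_j = T⁻¹ ∑_t Z_t^{(j)} Y_{t+1} Y_{t+1}ᵀ - (T⁻¹ ∑_t Z_t^{(j)}) (T⁻¹ ∑_t Y_{t+1} Y_{t+1}ᵀ)`. -/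
def deltaHat {k m T : ℕ} (x : Sample k m T) (j : Fin m) : Matrix (Fin k) (Fin k) ℝ :=
  Matrix.of fun a b =>
    (T : ℝ)⁻¹ * ∑ t, (x t).1 j * ((x t).2 a * (x t).2 b)
      - ((T : ℝ)⁻¹ * ∑ t, (x t).1 j) * ((T : ℝ)⁻¹ * ∑ t, (x t).2 a * (x t).2 b)

/-- `Ĝ`: the `m × k²` matrix whose `j`-th row is `vec(Δ̂_j)ᵀ`. -/
def GHat {k m T : ℕ} (x : Sample k m T) : Matrix (Fin m) (Fin k × Fin k) ℝ :=
  Matrix.of fun j => Matrix.vec (deltaHat x j)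

/-- `Γ̂ = {γ : ‖θ̂(γ)‖² - φ(θ̂) ≤ κ²}`. -/
def GammaHat {k m T : ℕ} (κ : ℝ) (x : Sample k m T) : Set (Sph k) :=
  {γ | ‖thetaHat x γ‖ ^ 2 - phi (thetaHat x) ≤ κ ^ 2}

/-- `B = {v ∈ ℝᵏ : ‖v‖ ≤ κ^{-1/2}}`. -/
def Bset (k : ℕ) (κ : ℝ) : Set (Vec k) := {v | ‖v‖ ≤ κ ^ (-(1 / 2) : ℝ)}

/-- The structural estimator of the second order derivative,
`φ̂''(h) = inf_{γ ∈ Γ̂} min_{v ∈ B} ‖h(γ) + Ĝ vec(v vᵀ)‖²`. -/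
def phiHat'' {k m T : ℕ} (κ : ℝ) (x : Sample k m T) (h : Dspace k m) : ℝ :=
  ⨅ γ : GammaHat κ x, ⨅ v : Bset k κ, ‖h (γ : Sph k) + applyVec (GHat x) (v : Vec k)‖ ^ 2

/-! ### Population quantities

The time index of the processes starts at `0`.  By stationarity the moments below do not depend on
the date, and they are written at date `0`. -/

section Population

variable {Ω : Type*} {mΩ : MeasurableSpace Ω} {k m : ℕ}

/-- The observed sample: the pairs `(Z_t, Y_{t+1})`, for `T` consecutive dates. -/
def sample (Y : ℕ → Ω → Vec k) (Z : ℕ → Ω → Vec m) (T : ℕ) (ω : Ω) : Sample k m T :=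
  fun t => (Z t ω, Y (t + 1) ω)

/-- `c(γ) = E[(γᵀ Y_{t+1})²]`. -/
def cPop (P : Measure Ω) (Y : ℕ → Ω → Vec k) (γ : Vec k) : ℝ :=
  ∫ ω, (inner ℝ γ (Y 1 ω)) ^ 2 ∂P

/-- `θ₀(γ) = E[Z_t {(γᵀ Y_{t+1})² - c(γ)}]`. -/
def theta0 (P : Measure Ω) (Y : ℕ → Ω → Vec k) (Z : ℕ → Ω → Vec m) (γ : Sph k) : Vec m :=
  ∫ ω, ((inner ℝ (γ : Vec k) (Y 1 ω)) ^ 2 - cPop P Y γ) • Z 0 ω ∂P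

/-- The identified set `Γ₀ = {γ : θ₀(γ) = 0}`. -/
def Gamma0 (P : Measure Ω) (Y : ℕ → Ω → Vec k) (Z : ℕ → Ω → Vec m) : Set (Sph k) :=
  {γ | theta0 P Y Z γ = 0}

/-- `Δ_j = E[Z_t^{(j)} (Y_{t+1} Y_{t+1}ᵀ - E[Y_{t+1} Y_{t+1}ᵀ])]`. -/
def DeltaPop (P : Measure Ω) (Y : ℕ → Ω → Vec k) (Z : ℕ → Ω → Vec m) (j : Fin m) :
    Matrix (Fin k) (Fin k) ℝ :=
  Matrix.of fun a b =>
    ∫ ω, Z 0 ω j * (Y 1 ω a * Y 1 ω b - ∫ ω', Y 1 ω' a * Y 1 ω' b ∂P) ∂P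

/-- `G`: the `m × k²` matrix whose `j`-th row is `vec(Δ_j)ᵀ`. -/
def GPop (P : Measure Ω) (Y : ℕ → Ω → Vec k) (Z : ℕ → Ω → Vec m) :
    Matrix (Fin m) (Fin k × Fin k) ℝ :=
  Matrix.of fun j => Matrix.vec (DeltaPop P Y Z j)

/-- `min_{γ₀ ∈ Γ₀} min_{v ∈ ℝᵏ} ‖h(γ₀) + G vec(v vᵀ)‖²`. -/
def phi'' (P : Measure Ω) (Y : ℕ → Ω → Vec k) (Z : ℕ → Ω → Vec m) (h : Dspace k m) : ℝ :=
  ⨅ γ : Gamma0 P Y Z, ⨅ v : Vec k, ‖h (γ : Sph k) + applyVec (GPop P Y Z) v‖ ^ 2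

/-! ### The model -/

/-- The process `(Y_t, Z_t)` is strictly stationary and ergodic: the shift of the path space
preserves the law of the process and is ergodic for it. -/
def IsStationaryErgodic (P : Measure Ω) (Y : ℕ → Ω → Vec k) (Z : ℕ → Ω → Vec m) : Prop :=
  Ergodic (fun (u : ℕ → Vec k × Vec m) t => u (t + 1)) (P.map fun ω t => (Y t ω, Z t ω))

/-- The conditionally heteroskedastic factor model with instruments `Z`. -/
structure Setup {p : ℕ} (P : Measure Ω) (F : Filtration ℕ mΩ)
    (Y : ℕ → Ω → Vec k) (Z : ℕ → Ω → Vec m) (σ2 : ℕ → Ω → Fin p → ℝ)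
    (L : Matrix (Fin k) (Fin p) ℝ) (Om : Matrix (Fin k) (Fin k) ℝ) : Prop where
  adapted_Y : Adapted F Y
  adapted_σ2 : Adapted F σ2
  posSemidef_Om : Om.PosSemidef
  /-- `Var(Y_{t+1} | F_t) = L D_t Lᵀ + Om` with `D_t = diag(σ2_t)`, entry by entry. -/
  condVar : ∀ t (a b : Fin k),
    P[fun ω => (Y (t + 1) ω a - (P[fun ω' => Y (t + 1) ω' a | F t]) ω)
        * (Y (t + 1) ω b - (P[fun ω' => Y (t + 1) ω' b | F t]) ω) | F t]
      =ᵐ[P] fun ω => (L * Matrix.diagonal (σ2 t ω) * Lᵀ + Om) a b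
  /-- `L` has full column rank. -/
  rank_L : L.rank = p
  /-- `Var(σ2_t)` is nonsingular. -/
  var_σ2 : ∀ t, (Matrix.of fun i j : Fin p =>
    cov[fun ω => σ2 t ω i, fun ω => σ2 t ω j; P]).det ≠ 0
  /-- `E[Y_{t+1} | F_t] = 0`. -/
  condMean : ∀ t, P[Y (t + 1) | F t] =ᵐ[P] 0
  adapted_Z : Adapted F Z
  /-- `Var(Z_t)` is nonsingular. -/
  var_Z : ∀ t, (Matrix.of fun i j : Fin m =>
    cov[fun ω => Z t ω i, fun ω => Z t ω j; P]).det ≠ 0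
  /-- `Cov(Z_t, σ2_t)` has full column rank. -/
  cov_Z_σ2 : ∀ t, (Matrix.of fun (i : Fin m) (j : Fin p) =>
    cov[fun ω => Z t ω i, fun ω => σ2 t ω j; P]).rank = p
  stationary_ergodic : IsStationaryErgodic P Y Z
  /-- `E‖Z_t‖² < ∞`. -/
  moment_Z : ∀ t, MemLp (Z t) 2 P
  /-- `E‖Y_t‖⁴ < ∞`. -/
  moment_Y : ∀ t, MemLp (Y t) 4 P

/-! ### The central limit theorem and the limiting Gaussian process -/

/-- Index set of the stacked vector `(Z, vec(Y Yᵀ), vec(Y Yᵀ) ⊗ Z)`. -/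
abbrev MomentIndex (k m : ℕ) : Type :=
  Fin m ⊕ (Fin k × Fin k) ⊕ ((Fin k × Fin k) × Fin m)

/-- The stacked vector `(z, vec(y yᵀ), vec(y yᵀ) ⊗ z)`. -/
def moments (z : Vec m) (y : Vec k) : EuclideanSpace ℝ (MomentIndex k m) :=
  WithLp.toLp 2 (Sum.elim (fun j => z j)
    (Sum.elim (fun ab => y ab.1 * y ab.2) (fun abj => y abj.1.1 * y abj.1.2 * z abj.2)))

/-- The vectors `Z_t`, `vec(Y_{t+1} Y_{t+1}ᵀ)` and `vec(Y_{t+1} Y_{t+1}ᵀ) ⊗ Z_t` fulfill (jointly)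
the central limit theorem: `√T` times the deviation of their sample mean from their expectation
converges in distribution to the centered Gaussian law `ν`. -/
structure FulfillsCLT (P : Measure Ω) [IsProbabilityMeasure P] (Y : ℕ → Ω → Vec k)
    (Z : ℕ → Ω → Vec m) (ν : Measure (EuclideanSpace ℝ (MomentIndex k m))) [IsGaussian ν] :
    Prop where
  centered : ∫ ξ, ξ ∂ν = 0
  tendsto : TendstoInDistribution
    (fun (T : ℕ) ω => √(T : ℝ) • ((T : ℝ)⁻¹ • ∑ t : Fin T, moments (Z t ω) (Y (t + 1) ω)
      - ∫ ω', moments (Z 0 ω') (Y 1 ω') ∂P)) atTop id (fun _ => P) ν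

/-- The `j`-th coordinate at `γ` of the limiting process `𝔾`, as a function of the Gaussian limit
`ξ = (ξ^Z, ξ^Y, ξ^{YZ})` of the central limit theorem.  Up to an asymptotically negligible term,
`√T {θ̂(γ) - θ₀(γ)}` is this function of the normalized sample mean of the stacked vector. -/
def GprocCoord (P : Measure Ω) (Y : ℕ → Ω → Vec k) (Z : ℕ → Ω → Vec m)
    (ξ : EuclideanSpace ℝ (MomentIndex k m)) (γ : Vec k) (j : Fin m) : ℝ :=
  ∑ a, ∑ b, γ a * γ b *
      (ξ (Sum.inr (Sum.inr ((a, b), j))) - (∫ ω, Z 0 ω j ∂P) * ξ (Sum.inr (Sum.inl (a, b))))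
    - (∑ a, ∑ b, γ a * γ b * ∫ ω, Y 1 ω a * Y 1 ω b ∂P) * ξ (Sum.inl j)

theorem continuous_GprocCoord (P : Measure Ω) (Y : ℕ → Ω → Vec k) (Z : ℕ → Ω → Vec m)
    (ξ : EuclideanSpace ℝ (MomentIndex k m)) :
    Continuous fun γ : Sph k =>
      (WithLp.toLp 2 (GprocCoord P Y Z ξ (γ : Vec k)) : Vec m) := by
  unfold GprocCoord
  fun_prop

/-- The centered Gaussian process `𝔾`, the weak limit of `√T {θ̂_T - θ₀}`, realized on the
probability space carrying the Gaussian limit `ξ` of the central limit theorem. -/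
def Gproc (P : Measure Ω) (Y : ℕ → Ω → Vec k) (Z : ℕ → Ω → Vec m)
    (ξ : EuclideanSpace ℝ (MomentIndex k m)) : Dspace k m :=
  ⟨fun γ => WithLp.toLp 2 (GprocCoord P Y Z ξ (γ : Vec k)),
    memlp_of_continuous (continuous_GprocCoord P Y Z ξ)⟩

/-- The cdf of `min_{γ₀ ∈ Γ₀} min_{v ∈ ℝᵏ} ‖𝔾(γ₀) + G vec(v vᵀ)‖²`. -/
def limitCdf (P : Measure Ω) (Y : ℕ → Ω → Vec k) (Z : ℕ → Ω → Vec m)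
    (ν : Measure (EuclideanSpace ℝ (MomentIndex k m))) (c : ℝ) : ℝ :=
  ν.real {ξ | phi'' P Y Z (Gproc P Y Z ξ) ≤ c}

/-! ### Quantiles, bounded Lipschitz functions, measurable majorants -/

/-- The `q`-quantile `inf {c : q ≤ H c}` of a distribution function `H`. -/
def quantile (H : ℝ → ℝ) (q : ℝ) : ℝ := sInf {c | q ≤ H c}

/-- `H` is strictly increasing at the point `c`. -/
def StrictlyIncreasingAt (H : ℝ → ℝ) (c : ℝ) : Prop :=
  (∀ x < c, H x < H c) ∧ ∀ x > c, H c < H x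

/-- `BL₁`: functions whose supremum norm and Lipschitz constant sum up to at most one. -/
def BL1 (E : Type*) [NormedAddCommGroup E] : Set (E → ℝ) :=
  {f | ∃ a b : ℝ, 0 ≤ b ∧ a + b ≤ 1 ∧ (∀ x, |f x| ≤ a) ∧ ∀ x y, |f x - f y| ≤ b * ‖x - y‖}

/-- `U` is a minimal measurable majorant of `g` with respect to `μ`. -/
def IsMinMajorant {α : Type*} [MeasurableSpace α] (μ : Measure α) (g U : α → ℝ) : Prop :=
  Measurable U ∧ (∀ x, g x ≤ U x) ∧
    ∀ V : α → ℝ, Measurable V → (∀ x, g x ≤ V x) → U ≤ᵐ[μ] V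

/-- `V` is a maximal measurable minorant of `g` with respect to `μ`. -/
def IsMaxMinorant {α : Type*} [MeasurableSpace α] (μ : Measure α) (g V : α → ℝ) : Prop :=
  Measurable V ∧ (∀ x, V x ≤ g x) ∧
    ∀ U : α → ℝ, Measurable U → (∀ x, U x ≤ g x) → U ≤ᵐ[μ] V

/-! ### The bootstrap

The weights live on a probability space `(W, Q)` of their own and the bootstrap sample of size `T`
is a function of the data `{(Z_t, Y_{t+1})}` and of the weights, so that under `P.prod Q` the
weights are independent of the data.  No measurability of the resampling map is imposed. Measures
of non-measurable sets are outer measures in Mathlib, as they should be here. -/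

variable {W : Type*} [MeasurableSpace W]

/-- A resampling scheme: the bootstrap sample `{(Z*_t, Y*_{t+1})}` as a function of data and
weights, for each sample size. -/
abbrev Resampling (k m : ℕ) (W : Type*) : Type _ :=
  (T : ℕ) → Sample k m T → W → Sample k m T

/-- `√T {θ̂*_T - θ̂_T}`, where `θ̂*_T` is `θ̂` evaluated at the bootstrap sample. -/
def bootProc (R : Resampling k m W) (T : ℕ) (x : Sample k m T) (w : W) : Dspace k m :=
  √(T : ℝ) • (thetaHatD (R T x w) - thetaHatD x)

/-- `sup_{f ∈ BL₁} |E_W[f(√T {θ̂*_T - θ̂_T})] - E[f(𝔾)]|`, as a function of the data. -/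
def bootDist (P : Measure Ω) (Q : Measure W) (Y : ℕ → Ω → Vec k) (Z : ℕ → Ω → Vec m)
    (ν : Measure (EuclideanSpace ℝ (MomentIndex k m))) (R : Resampling k m W) (T : ℕ)
    (ω : Ω) : ℝ :=
  ⨆ f : BL1 (Dspace k m), |∫ w, f.1 (bootProc R T (sample Y Z T ω) w) ∂Q
    - ∫ ξ, f.1 (Gproc P Y Z ξ) ∂ν|

/-- Consistency of the bootstrap for `𝔾`: the bounded Lipschitz distance is `o_p(1)`. -/
def BootstrapConsistent (P : Measure Ω) (Q : Measure W) (Y : ℕ → Ω → Vec k)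
    (Z : ℕ → Ω → Vec m) (ν : Measure (EuclideanSpace ℝ (MomentIndex k m)))
    (R : Resampling k m W) : Prop :=
  TendstoInMeasure P (bootDist P Q Y Z ν R) atTop fun _ => 0

/-- Measurability of the bootstrap. -/
structure BootstrapMeasurable (P : Measure Ω) (Q : Measure W) (Y : ℕ → Ω → Vec k)
    (Z : ℕ → Ω → Vec m) (R : Resampling k m W) : Prop where
  /-- Asymptotic measurability: the expectations of the minimal measurable majorant and of the
  maximal measurable minorant, jointly in data and weights, become equal. -/
  asymptotic : ∀ f ∈ BL1 (Dspace k m), ∃ U V : ℕ → Ω × W → ℝ,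
    (∀ T, IsMinMajorant (P.prod Q) (fun q => f (bootProc R T (sample Y Z T q.1) q.2)) (U T)) ∧
    (∀ T, IsMaxMinorant (P.prod Q) (fun q => f (bootProc R T (sample Y Z T q.1) q.2)) (V T)) ∧
    Tendsto (fun T => ∫ q, U T q ∂(P.prod Q) - ∫ q, V T q ∂(P.prod Q)) atTop (𝓝 0)
  /-- For almost all data, continuous bounded functions are measurable in the weights. -/
  weights : ∀ f : Dspace k m → ℝ, Continuous f → (∃ C, ∀ h, |f h| ≤ C) →
    ∀ T, ∀ᵐ ω ∂P, Measurable fun w => f (bootProc R T (sample Y Z T ω) w)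

/-- The bootstrap critical value
`ĉ_{1-α} = inf {c : P_W(φ̂''_T(√T {θ̂*_T - θ̂_T}) ≤ c) ≥ 1 - α}`, as a function of the data. -/
def critVal (Q : Measure W) (R : Resampling k m W) (κ : ℕ → ℝ) (α : ℝ) (T : ℕ)
    (x : Sample k m T) : ℝ :=
  quantile (fun c => Q.real {w | phiHat'' (κ T) x (bootProc R T x w) ≤ c}) (1 - α)

end Population

end CommonCH

end

noncomputable section

namespace CommonCH

/-! ### Quadratic maps on the sphere -/

section Quadratic

variable {k m : ℕ}

/-! Every random element of the problem is a quadratic map `γ ↦ A vec(γγᵀ)`: the estimator, its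
population counterpart, the bootstrap difference and the limit `𝔾`. All of them therefore lie in the
finite-dimensional range of `quadD`, where one sup norm over the sphere controls size and Lipschitz
constant alike.

Identification is linear. In the factor model `G vec(vvᵀ) = C ((λ_iᵀv)²)_i`, where `λ_i` are the
columns of the loading matrix and `C = Cov(Z, σ²)` is injective. So `G` vanishes exactly on the
subspace `K` orthogonal to all loadings, ignores components in `K`, and grows quadratically on `Kᗮ`
(`SeparatesFrom`, `exists_separatesFrom_GPop`).

This gives deterministic comparisons on the square root scale. With `s = T^{1/4}` and `A = √T(Ĝ -
G)`, the statistic minimizes `‖s²Gγ + Aγ‖`. Near-minimizers are `γ₀ + w/s` with `γ₀ ∈ K` and `w ∈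
Kᗮ` bounded, and there the value is about `‖Aγ₀ + Gw‖` (`abs_sqrt_phi_sub_le`). Likewise the
derivative estimator at a bounded quadratic map is close to the limiting functional once `‖Ĝ - G‖`
is small relative to `κ` (`abs_sqrt_derivEstimator_sub_le`). Both approximate the same 1-Lipschitz
functional `rootLimit`, at the data process and at the bootstrap process respectively.

What remains is weak convergence of Lipschitz functionals: the CLT with the portmanteau theorem
(`eventually_data_le`), and ramps tested against the bounded Lipschitz distance
(`eventually_boot_le`). Only upper bounds by subadditivity are used, so outer measures suffice. The
quantile then converges (`eventually_critVal`), and a sandwich at a continuity point gives the size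
(`tendsto_rejection`). -/

theorem applyVec_apply (A : Matrix (Fin m) (Fin k × Fin k) ℝ) (v : Vec k) (j : Fin m) :
    applyVec A v j = ∑ a, ∑ b, A j (a, b) * (v a * v b) := by
  simp only [applyVec, Matrix.mulVec, dotProduct, Fintype.sum_prod_type, Matrix.vec,
    Matrix.vecMulVec_apply]
  exact Finset.sum_congr rfl fun a _ => Finset.sum_congr rfl fun b _ => by ring

theorem applyVec_add_matrix (A B : Matrix (Fin m) (Fin k × Fin k) ℝ) (v : Vec k) :
    applyVec (A + B) v = applyVec A v + applyVec B v := by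
  ext j
  simp [applyVec_apply, add_mul, Finset.sum_add_distrib]

theorem applyVec_smul_matrix (s : ℝ) (A : Matrix (Fin m) (Fin k × Fin k) ℝ) (v : Vec k) :
    applyVec (s • A) v = s • applyVec A v := by
  ext j
  simp [applyVec_apply, Finset.mul_sum, mul_assoc]

theorem applyVec_smul (A : Matrix (Fin m) (Fin k × Fin k) ℝ) (s : ℝ) (v : Vec k) :
    applyVec A (s • v) = s ^ 2 • applyVec A v := by
  ext j
  simp only [applyVec_apply, PiLp.smul_apply, smul_eq_mul, Finset.mul_sum]
  exact Finset.sum_congr rfl fun a _ => Finset.sum_congr rfl fun b _ => by ring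

theorem applyVec_zero (A : Matrix (Fin m) (Fin k × Fin k) ℝ) : applyVec A 0 = 0 := by
  ext j
  simp [applyVec_apply]

theorem continuous_applyVec (A : Matrix (Fin m) (Fin k × Fin k) ℝ) : Continuous (applyVec A) := by
  have h : applyVec A = fun v => WithLp.toLp 2 fun j => ∑ a, ∑ b, A j (a, b) * (v a * v b) := by
    funext v; ext j; simp [applyVec_apply]
  rw [h]
  fun_prop

/-- The map `γ ↦ A vec(γ γᵀ)` on the sphere, linear in `A`. -/
def quadD : Matrix (Fin m) (Fin k × Fin k) ℝ →ₗ[ℝ] Dspace k m where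
  toFun A := ⟨fun γ => applyVec A γ,
    memlp_of_continuous ((continuous_applyVec A).comp continuous_subtype_val)⟩
  map_add' A B := by
    ext1; funext γ; exact applyVec_add_matrix A B γ
  map_smul' s A := by
    ext1; funext γ; exact applyVec_smul_matrix s A γ

theorem quadD_apply (A : Matrix (Fin m) (Fin k × Fin k) ℝ) (γ : Sph k) :
    quadD A γ = applyVec A γ := rfl

/-- Homogeneity of degree two transports the bound from the sphere, where it is the sup norm. -/
theorem norm_applyVec_le (A : Matrix (Fin m) (Fin k × Fin k) ℝ) (v : Vec k) :
    ‖applyVec A v‖ ≤ ‖quadD A‖ * ‖v‖ ^ 2 := by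
  by_cases hv : v = 0
  · simp [hv, applyVec_zero]
  have hn : ‖v‖ ≠ 0 := norm_ne_zero_iff.2 hv
  have hu : ‖v‖⁻¹ • v ∈ Metric.sphere (0 : Vec k) 1 := by
    simp [norm_smul, hn]
  have h1 : v = ‖v‖ • (‖v‖⁻¹ • v) := by rw [smul_smul, mul_inv_cancel₀ hn, one_smul]
  have h2 := lp.norm_apply_le_norm ENNReal.top_ne_zero (quadD A) ⟨_, hu⟩
  rw [quadD_apply] at h2
  conv_lhs => rw [h1]
  rw [applyVec_smul, norm_smul, Real.norm_of_nonneg (by positivity), mul_comm]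
  gcongr

/-- The polarization of `v ↦ A vec(v vᵀ)`. -/
def polarVec (A : Matrix (Fin m) (Fin k × Fin k) ℝ) (u w : Vec k) : Vec m :=
  applyVec A (u + w) - applyVec A u - applyVec A w

theorem polarVec_apply (A : Matrix (Fin m) (Fin k × Fin k) ℝ) (u w : Vec k) (j : Fin m) :
    polarVec A u w j = ∑ a, ∑ b, A j (a, b) * (u a * w b + w a * u b) := by
  simp only [polarVec, PiLp.sub_apply, applyVec_apply, ← Finset.sum_sub_distrib, PiLp.add_apply]
  exact Finset.sum_congr rfl fun a _ => Finset.sum_congr rfl fun b _ => by ring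

theorem polarVec_smul_smul (A : Matrix (Fin m) (Fin k × Fin k) ℝ) (s t : ℝ) (u w : Vec k) :
    polarVec A (s • u) (t • w) = (s * t) • polarVec A u w := by
  ext j
  simp only [polarVec_apply, PiLp.smul_apply, smul_eq_mul, Finset.mul_sum]
  exact Finset.sum_congr rfl fun a _ => Finset.sum_congr rfl fun b _ => by ring

theorem two_smul_polarVec (A : Matrix (Fin m) (Fin k × Fin k) ℝ) (u w : Vec k) :
    (2 : ℝ) • polarVec A u w = applyVec A (u + w) - applyVec A (u - w) := by
  ext j
  simp only [polarVec_apply, PiLp.smul_apply, smul_eq_mul, Finset.mul_sum, PiLp.sub_apply,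
    applyVec_apply, ← Finset.sum_sub_distrib, PiLp.add_apply]
  exact Finset.sum_congr rfl fun a _ => Finset.sum_congr rfl fun b _ => by ring

/-- Polarization and the parallelogram law; rescaling `u` and `w` to unit length then gives the
product form. -/
theorem norm_polarVec_le_add (A : Matrix (Fin m) (Fin k × Fin k) ℝ) (u w : Vec k) :
    ‖polarVec A u w‖ ≤ ‖quadD A‖ * (‖u‖ ^ 2 + ‖w‖ ^ 2) := by
  have h := congrArg norm (two_smul_polarVec A u w)
  rw [norm_smul, Real.norm_of_nonneg zero_le_two] at h
  have h1 := norm_sub_le (applyVec A (u + w)) (applyVec A (u - w))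
  have h2 := norm_applyVec_le A (u + w)
  have h3 := norm_applyVec_le A (u - w)
  have h4 := parallelogram_law_with_norm ℝ u w
  have h5 : ‖quadD A‖ * ‖u + w‖ ^ 2 + ‖quadD A‖ * ‖u - w‖ ^ 2
      = 2 * (‖quadD A‖ * (‖u‖ ^ 2 + ‖w‖ ^ 2)) := by
    rw [← mul_add, h4]; ring
  linarith

theorem norm_polarVec_le (A : Matrix (Fin m) (Fin k × Fin k) ℝ) (u w : Vec k) :
    ‖polarVec A u w‖ ≤ 2 * ‖quadD A‖ * (‖u‖ * ‖w‖) := by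
  by_cases hu : u = 0
  · simp [hu, polarVec, applyVec_zero]
  by_cases hw : w = 0
  · simp [hw, polarVec, applyVec_zero]
  have hu' : ‖u‖ ≠ 0 := norm_ne_zero_iff.2 hu
  have hw' : ‖w‖ ≠ 0 := norm_ne_zero_iff.2 hw
  have h1 : u = ‖u‖ • (‖u‖⁻¹ • u) := by rw [smul_smul, mul_inv_cancel₀ hu', one_smul]
  have h2 : w = ‖w‖ • (‖w‖⁻¹ • w) := by rw [smul_smul, mul_inv_cancel₀ hw', one_smul]
  have h3 := norm_polarVec_le_add A (‖u‖⁻¹ • u) (‖w‖⁻¹ • w)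
  have h4 : ‖‖u‖⁻¹ • u‖ = 1 := by simp [norm_smul, hu']
  have h5 : ‖‖w‖⁻¹ • w‖ = 1 := by simp [norm_smul, hw']
  rw [h4, h5] at h3
  conv_lhs => rw [h1, h2]
  rw [polarVec_smul_smul, norm_smul, Real.norm_of_nonneg (by positivity), mul_comm]
  gcongr
  linarith

/-- A quadratic map is Lipschitz on the sphere. -/
theorem norm_applyVec_sub_le (A : Matrix (Fin m) (Fin k × Fin k) ℝ) {x y : Vec k}
    (hx : ‖x‖ = 1) (hy : ‖y‖ = 1) :
    ‖applyVec A x - applyVec A y‖ ≤ 4 * ‖quadD A‖ * ‖x - y‖ := by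
  have h1 : applyVec A x - applyVec A y = applyVec A (x - y) + polarVec A y (x - y) := by
    simp [polarVec]
  have h2 := norm_applyVec_le A (x - y)
  have h3 := norm_polarVec_le A y (x - y)
  -- The sphere has diameter two, so the quadratic term in `x - y` is absorbed into a linear one; it
  -- and the polar term contribute two each to the constant four.
  have h4 : ‖x - y‖ ≤ 2 := by
    have := norm_sub_le x y
    linarith
  have h5 : ‖quadD A‖ * ‖x - y‖ ^ 2 ≤ ‖quadD A‖ * (2 * ‖x - y‖) := by
    rw [pow_two]; gcongr
  rw [hy] at h3
  rw [h1]
  have := norm_add_le (applyVec A (x - y)) (polarVec A y (x - y))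
  linarith

/-- `v ↦ G vec(v vᵀ)` factors through the projection along `K`, and grows quadratically on the
orthogonal complement of `K`. -/
structure SeparatesFrom (G : Matrix (Fin m) (Fin k × Fin k) ℝ) (K : Submodule ℝ (Vec k))
    (c : ℝ) : Prop where
  pos : 0 < c
  add_left : ∀ x ∈ K, ∀ y, applyVec G (x + y) = applyVec G y
  le_norm : ∀ y ∈ Kᗮ, c * ‖y‖ ^ 2 ≤ ‖applyVec G y‖

namespace SeparatesFrom

variable {G : Matrix (Fin m) (Fin k × Fin k) ℝ} {K : Submodule ℝ (Vec k)} {c : ℝ}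

theorem applyVec_eq_zero (h : SeparatesFrom G K c) {x : Vec k} (hx : x ∈ K) :
    applyVec G x = 0 := by
  simpa [applyVec_zero] using h.add_left x hx 0

/-- The vector `v` may be replaced by its component in `Kᗮ`. -/
theorem exists_orthogonal (h : SeparatesFrom G K c) (v : Vec k) :
    ∃ x ∈ K, ∃ w ∈ Kᗮ, v = x + w ∧ applyVec G w = applyVec G v ∧
      ‖w‖ ^ 2 ≤ ‖applyVec G v‖ / c := by
  obtain ⟨x, hx, w, hw, rfl⟩ := K.exists_add_mem_mem_orthogonal v
  refine ⟨x, hx, w, hw, rfl, (h.add_left x hx w).symm, ?_⟩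
  rw [h.add_left x hx w, le_div_iff₀ h.pos, mul_comm]
  exact h.le_norm w hw

theorem applyVec_eq_zero_iff (h : SeparatesFrom G K c) {x : Vec k} :
    applyVec G x = 0 ↔ x ∈ K := by
  refine ⟨fun h0 => ?_, h.applyVec_eq_zero⟩
  obtain ⟨y, hy, w, -, rfl, -, hw⟩ := h.exists_orthogonal x
  rw [h0, norm_zero, zero_div] at hw
  have : w = 0 := by
    have h1 : ‖w‖ ^ 2 = 0 := le_antisymm hw (by positivity)
    simpa using h1
  simpa [this] using hy

/-- A unit vector at which the quadratic map is small is close to a unit vector of `K`. -/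
theorem exists_near (h : SeparatesFrom G K c) (hK : ∃ x ∈ K, ‖x‖ = 1) {γ : Vec k}
    (hγ : ‖γ‖ = 1) :
    ∃ w : Vec k, applyVec G w = applyVec G γ ∧ ‖w‖ ^ 2 ≤ ‖applyVec G γ‖ / c ∧
      ∃ γ₀ ∈ K, ‖γ₀‖ = 1 ∧ ‖γ - γ₀‖ ≤ 2 * ‖w‖ := by
  obtain ⟨x, hx, w, hw, rfl, h1, h2⟩ := h.exists_orthogonal γ
  refine ⟨w, h1, h2, ?_⟩
  by_cases hx0 : x = 0
  -- Here `γ = w` is a unit vector, so any unit vector of `K` is within distance `2 = 2‖w‖`.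
  · obtain ⟨γ₀, h3, h4⟩ := hK
    refine ⟨γ₀, h3, h4, ?_⟩
    have := norm_sub_le (x + w) γ₀
    rw [hx0, zero_add] at hγ this ⊢
    linarith
  have hn : ‖x‖ ≠ 0 := norm_ne_zero_iff.2 hx0
  have hp : 0 < ‖x‖ := norm_pos_iff.2 hx0
  refine ⟨‖x‖⁻¹ • x, K.smul_mem _ hx, by simp [norm_smul, hn], ?_⟩
  -- Normalizing `x` moves it by `|‖x‖ - ‖γ‖|`, at most `‖w‖` by the reverse triangle inequality.
  have h3 : ‖x - ‖x‖⁻¹ • x‖ ≤ ‖w‖ := by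
    have h4 : x - ‖x‖⁻¹ • x = (1 - ‖x‖⁻¹) • x := by rw [sub_smul, one_smul]
    rw [h4, norm_smul, Real.norm_eq_abs]
    have h5 : |1 - ‖x‖⁻¹| * ‖x‖ = |‖x‖ - 1| := by
      rw [← abs_of_pos hp, ← abs_mul, abs_of_pos hp, sub_mul, inv_mul_cancel₀ hn, one_mul]
    rw [h5, ← hγ]
    have h6 := abs_norm_sub_norm_le x (x + w)
    simpa using h6
  calc ‖x + w - ‖x‖⁻¹ • x‖ = ‖(x - ‖x‖⁻¹ • x) + w‖ := by congr 1; abel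
    _ ≤ ‖x - ‖x‖⁻¹ • x‖ + ‖w‖ := norm_add_le _ _
    _ ≤ 2 * ‖w‖ := by linarith

end SeparatesFrom

end Quadratic

/-! ### Square roots of infima of squared norms -/

section Infimum

variable {ι κ E : Type*} [SeminormedAddCommGroup E]

theorem bddBelow_range_sq_norm (f : ι → E) : BddBelow (Set.range fun i => ‖f i‖ ^ 2) :=
  ⟨0, by rintro _ ⟨i, rfl⟩; positivity⟩

theorem iInf_sq_norm_nonneg (f : ι → E) : 0 ≤ ⨅ i, ‖f i‖ ^ 2 :=
  Real.iInf_nonneg fun _ => by positivity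

theorem sqrt_iInf_sq_norm_le (f : ι → E) (i : ι) : √(⨅ i, ‖f i‖ ^ 2) ≤ ‖f i‖ := by
  rw [Real.sqrt_le_left (norm_nonneg _)]
  exact ciInf_le (bddBelow_range_sq_norm f) i

/-- Nonemptiness matters: the real infimum over an empty index is zero. Negative `b` is allowed, so
that error terms can be subtracted freely. -/
theorem le_sqrt_iInf_sq_norm [Nonempty ι] {f : ι → E} {b : ℝ} (h : ∀ i, b ≤ ‖f i‖) :
    b ≤ √(⨅ i, ‖f i‖ ^ 2) := by
  rcases le_total b 0 with hb | hb
  · exact hb.trans (Real.sqrt_nonneg _)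
  exact Real.le_sqrt_of_sq_le (le_ciInf fun i => by gcongr; exact h i)

theorem bddBelow_range_iInf_sq_norm (f : ι → κ → E) :
    BddBelow (Set.range fun i => ⨅ l, ‖f i l‖ ^ 2) :=
  ⟨0, by rintro _ ⟨i, rfl⟩; exact iInf_sq_norm_nonneg _⟩

theorem sqrt_iInf_iInf_sq_norm_le (f : ι → κ → E) (i : ι) (l : κ) :
    √(⨅ i, ⨅ l, ‖f i l‖ ^ 2) ≤ ‖f i l‖ := by
  rw [Real.sqrt_le_left (norm_nonneg _)]
  exact (ciInf_le (bddBelow_range_iInf_sq_norm f) i).trans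
    (ciInf_le (bddBelow_range_sq_norm (f i)) l)

theorem le_sqrt_iInf_iInf_sq_norm [Nonempty ι] [Nonempty κ] {f : ι → κ → E} {b : ℝ}
    (h : ∀ i l, b ≤ ‖f i l‖) : b ≤ √(⨅ i, ⨅ l, ‖f i l‖ ^ 2) := by
  rcases le_total b 0 with hb | hb
  · exact hb.trans (Real.sqrt_nonneg _)
  exact Real.le_sqrt_of_sq_le (le_ciInf fun i => le_ciInf fun l => by gcongr; exact h i l)

end Infimum

/-! ### Comparison of the sample functionals with the limiting functional -/

section Comparison

variable {k m : ℕ} {G : Matrix (Fin m) (Fin k × Fin k) ℝ} {K : Submodule ℝ (Vec k)} {c : ℝ}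
  {Γ : Set (Sph k)}

/-- `min_{γ ∈ Γ} min_v ‖h(γ) + G vec(v vᵀ)‖`. -/
def rootDeriv (G : Matrix (Fin m) (Fin k × Fin k) ℝ) (Γ : Set (Sph k)) (h : Dspace k m) : ℝ :=
  √(⨅ γ : Γ, ⨅ v : Vec k, ‖h (γ : Sph k) + applyVec G v‖ ^ 2)

theorem rootDeriv_le (h : Dspace k m) {γ : Sph k} (hγ : γ ∈ Γ) (v : Vec k) :
    rootDeriv G Γ h ≤ ‖h γ + applyVec G v‖ :=
  sqrt_iInf_iInf_sq_norm_le (fun (γ : Γ) (v : Vec k) => h (γ : Sph k) + applyVec G v) ⟨γ, hγ⟩ v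

theorem le_rootDeriv (hΓ : Γ.Nonempty) {h : Dspace k m} {b : ℝ}
    (hb : ∀ γ ∈ Γ, ∀ v, b ≤ ‖h γ + applyVec G v‖) : b ≤ rootDeriv G Γ h := by
  have := hΓ.to_subtype
  exact le_sqrt_iInf_iInf_sq_norm fun γ v => hb γ γ.2 v

theorem norm_apply_le (h : Dspace k m) (γ : Sph k) : ‖h γ‖ ≤ ‖h‖ :=
  lp.norm_apply_le_norm ENNReal.top_ne_zero h γ

theorem rootDeriv_le_norm (hΓ : Γ.Nonempty) (h : Dspace k m) : rootDeriv G Γ h ≤ ‖h‖ := by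
  obtain ⟨γ, hγ⟩ := hΓ
  have := rootDeriv_le (G := G) h hγ 0
  rw [applyVec_zero, add_zero] at this
  exact this.trans (norm_apply_le h γ)

theorem rootDeriv_sub_le (hΓ : Γ.Nonempty) (h h' : Dspace k m) :
    rootDeriv G Γ h - rootDeriv G Γ h' ≤ ‖h - h'‖ := by
  rw [sub_le_comm]
  refine le_rootDeriv hΓ fun γ hγ v => ?_
  have h1 := rootDeriv_le (G := G) h hγ v
  have h2 := norm_apply_le (h - h') γ
  have h3 : h γ + applyVec G v = (h - h') γ + (h' γ + applyVec G v) := by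
    simp only [lp.coeFn_sub, Pi.sub_apply]
    abel
  rw [h3] at h1
  have := norm_add_le ((h - h') γ) (h' γ + applyVec G v)
  linarith

/-- The minimum over `v` may be restricted to small vectors. -/
theorem SeparatesFrom.exists_small (hG : SeparatesFrom G K c) {a : Vec m} {r : ℝ} (ha : ‖a‖ ≤ r)
    (v : Vec k) : ∃ w ∈ Kᗮ, ‖w‖ ^ 2 ≤ 2 * r / c ∧
      ‖a + applyVec G w‖ ≤ ‖a + applyVec G v‖ := by
  have hr : 0 ≤ r := (norm_nonneg a).trans ha
  have hc := hG.pos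
  -- A vector doing no better than `r` is replaced by zero. Otherwise `‖G vec(vvᵀ)‖ ≤ 2r`, and
  -- quadratic growth bounds the component in `Kᗮ`.
  by_cases hbig : r ≤ ‖a + applyVec G v‖
  · refine ⟨0, zero_mem _, by rw [norm_zero, zero_pow two_ne_zero]; positivity, ?_⟩
    rw [applyVec_zero, add_zero]
    exact ha.trans hbig
  obtain ⟨x, hx, w, hw, rfl, h1, h2⟩ := hG.exists_orthogonal v
  refine ⟨w, hw, h2.trans ?_, by rw [h1]⟩
  gcongr
  have h3 : applyVec G (x + w) = (a + applyVec G (x + w)) - a := by abel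
  rw [h3]
  have := norm_sub_le (a + applyVec G (x + w)) a
  linarith

variable (hG : SeparatesFrom G K c) (hΓ : ∀ γ : Sph k, γ ∈ Γ ↔ (γ : Vec k) ∈ K)
  (hne : Γ.Nonempty)

/-- The modulus of approximation for the test statistic. -/
def statModulus (r c s : ℝ) : ℝ := 8 * r * (√(2 * r / c) / s)

/-- The ratio `t / s` is the scale by which a direction is moved. The factor eight is the Lipschitz
constant `4r` times a displacement of at most `2t / s`. -/
theorem le_statModulus {r c s t : ℝ} (hr : 0 ≤ r) (hs : 0 < s)
    (h : t ^ 2 ≤ 2 * r / c) : 8 * r * (t / s) ≤ statModulus r c s := by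
  unfold statModulus
  gcongr
  exact Real.le_sqrt_of_sq_le h

include hG hΓ hne in
/-- The limiting functional of a perturbation `A` is bounded by the values on the sphere of the
quadratic map `s² G + A`, up to an error that vanishes as `s` grows. -/
theorem rootDeriv_le_stat (A : Matrix (Fin m) (Fin k × Fin k) ℝ) {r s : ℝ} (hs : 0 < s)
    (hr : ‖quadD A‖ ≤ r) (γ : Sph k) :
    rootDeriv G Γ (quadD A) ≤ ‖s ^ 2 • applyVec G γ + applyVec A γ‖ + statModulus r c s := by
  have hr0 : 0 ≤ r := (norm_nonneg _).trans hr
  have hmod : 0 ≤ statModulus r c s := by unfold statModulus; positivity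
  -- The choice `v = 0` already bounds the functional by `r`. In the other case `s²Gγ` is at most
  -- `2r`, which forces `γ` to be within order `1/s` of `K`.
  by_cases hbig : r ≤ ‖s ^ 2 • applyVec G γ + applyVec A γ‖
  · have := rootDeriv_le_norm (G := G) hne (quadD A)
    linarith
  have hK : ∃ x ∈ K, ‖x‖ = 1 := by
    obtain ⟨γ, hγ⟩ := hne
    exact ⟨γ, (hΓ γ).1 hγ, norm_eq_of_mem_sphere γ⟩
  obtain ⟨w, h1, h2, γ₀, h3, h4, h5⟩ := hG.exists_near hK (norm_eq_of_mem_sphere γ)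
  have hc := hG.pos
  have hA : ‖applyVec A γ‖ ≤ r := (norm_apply_le (quadD A) γ).trans hr
  have h6 : ‖s ^ 2 • applyVec G γ‖ ≤ 2 * r := by
    have h7 : s ^ 2 • applyVec G γ = (s ^ 2 • applyVec G γ + applyVec A γ) - applyVec A γ := by abel
    rw [h7]
    have := norm_sub_le (s ^ 2 • applyVec G γ + applyVec A γ) (applyVec A γ)
    linarith
  have h8 : ‖s • w‖ ^ 2 ≤ 2 * r / c := by
    rw [norm_smul, mul_pow, Real.norm_of_nonneg hs.le]
    rw [norm_smul, Real.norm_of_nonneg (by positivity)] at h6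
    calc s ^ 2 * ‖w‖ ^ 2 ≤ s ^ 2 * (‖applyVec G γ‖ / c) := by gcongr
      _ = s ^ 2 * ‖applyVec G γ‖ / c := by ring
      _ ≤ _ := by gcongr
  have h9 := le_statModulus hr0 hs h8
  rw [norm_smul, Real.norm_of_nonneg hs.le, mul_div_cancel_left₀ _ hs.ne'] at h9
  -- The competitor is `v = s • w`, since `G` at `s • w` equals `s²` times `G` at `γ`.
  have h10 := rootDeriv_le (G := G) (quadD A) ((hΓ ⟨γ₀, by simpa using h4⟩).2 h3) (s • w)
  rw [quadD_apply, applyVec_smul, h1] at h10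
  have h11 := norm_applyVec_sub_le A h4 (norm_eq_of_mem_sphere γ)
  rw [norm_sub_rev γ₀] at h11
  have h12 : 4 * ‖quadD A‖ * ‖(γ : Vec k) - γ₀‖ ≤ 4 * r * (2 * ‖w‖) := by gcongr
  have h13 : applyVec A γ₀ + s ^ 2 • applyVec G γ
      = (s ^ 2 • applyVec G γ + applyVec A γ) + (applyVec A γ₀ - applyVec A γ) := by abel
  have h14 := norm_add_le (s ^ 2 • applyVec G γ + applyVec A γ) (applyVec A γ₀ - applyVec A γ)
  change _ ≤ ‖applyVec A γ₀ + s ^ 2 • applyVec G γ‖ at h10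
  rw [h13] at h10
  linarith

-- Tilting `γ₀` towards `w ∈ Kᗮ` by the angle scale `1/s` gives the competitor on the sphere. As `G`
-- ignores the component in `K`, the term `s²G` there equals `G vec(wwᵀ)` exactly; only `A`
-- contributes an error.
include hG hΓ in
theorem exists_stat_le (A : Matrix (Fin m) (Fin k × Fin k) ℝ) {r s : ℝ} (hs : 0 < s)
    (hr : ‖quadD A‖ ≤ r) (hrs : 2 * r / c ≤ s ^ 2) {γ₀ : Sph k} (hγ₀ : γ₀ ∈ Γ) (v : Vec k) :
    ∃ γ : Sph k, ‖s ^ 2 • applyVec G γ + applyVec A γ‖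
      ≤ ‖quadD A γ₀ + applyVec G v‖ + statModulus r c s := by
  have hr0 : 0 ≤ r := (norm_nonneg _).trans hr
  obtain ⟨w, hw, h1, h2⟩ := hG.exists_small ((norm_apply_le (quadD A) γ₀).trans hr) v
  have hn : ‖(γ₀ : Vec k)‖ = 1 := norm_eq_of_mem_sphere γ₀
  have hK := (hΓ γ₀).1 hγ₀
  have hx0 : 0 ≤ ‖w‖ / s := by positivity
  have hx1 : (‖w‖ / s) ^ 2 ≤ 1 := by
    rw [div_pow, div_le_one (by positivity)]; exact h1.trans hrs
  have h3 : inner ℝ (γ₀ : Vec k) w = 0 := hw _ hK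
  -- This weight puts `b γ₀ + w/s` on the sphere, by orthogonality; `hrs` makes the radicand
  -- nonnegative.
  set b := √(1 - (‖w‖ / s) ^ 2) with hb
  have hb2 : b ^ 2 = 1 - (‖w‖ / s) ^ 2 := Real.sq_sqrt (by linarith)
  have hb0 : 0 ≤ b := Real.sqrt_nonneg _
  have hw' : ‖s⁻¹ • w‖ = ‖w‖ / s := by
    rw [norm_smul, Real.norm_of_nonneg (by positivity)]; ring
  have h4 : ‖b • (γ₀ : Vec k) + s⁻¹ • w‖ = 1 := by
    have h5 := norm_add_sq_eq_norm_sq_add_norm_sq_of_inner_eq_zero (b • (γ₀ : Vec k)) (s⁻¹ • w)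
      (by rw [inner_smul_left, inner_smul_right, h3]; simp)
    rw [hw', norm_smul, hn, Real.norm_of_nonneg hb0] at h5
    have h6 : ‖b • (γ₀ : Vec k) + s⁻¹ • w‖ ^ 2 = 1 := by nlinarith
    nlinarith [norm_nonneg (b • (γ₀ : Vec k) + s⁻¹ • w)]
  refine ⟨⟨b • (γ₀ : Vec k) + s⁻¹ • w, by simpa using h4⟩, ?_⟩
  have h5 : ‖b • (γ₀ : Vec k) + s⁻¹ • w - γ₀‖ ≤ 2 * (‖w‖ / s) := by
    have h6 : b • (γ₀ : Vec k) + s⁻¹ • w - γ₀ = s⁻¹ • w - (1 - b) • (γ₀ : Vec k) := by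
      rw [sub_smul, one_smul]; abel
    have h7 := norm_sub_le (s⁻¹ • w) ((1 - b) • (γ₀ : Vec k))
    have h8 : b ≤ 1 := by nlinarith
    have h9 : 1 - b ≤ ‖w‖ / s := by nlinarith
    rw [hw', norm_smul, hn, Real.norm_of_nonneg (by linarith)] at h7
    rw [h6]
    linarith
  have h6 := norm_applyVec_sub_le A h4 hn
  have h7 : 4 * ‖quadD A‖ * ‖b • (γ₀ : Vec k) + s⁻¹ • w - γ₀‖ ≤ 4 * r * (2 * (‖w‖ / s)) := by
    gcongr
  have h8 := le_statModulus hr0 hs h1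
  have h9 : s ^ 2 • applyVec G (b • (γ₀ : Vec k) + s⁻¹ • w) = applyVec G w := by
    rw [hG.add_left _ (K.smul_mem _ hK), applyVec_smul, smul_smul, ← mul_pow,
      mul_inv_cancel₀ hs.ne', one_pow, one_smul]
  simp only [h9]
  have h10 : applyVec G w + applyVec A (b • (γ₀ : Vec k) + s⁻¹ • w)
      = (applyVec A γ₀ + applyVec G w)
        + (applyVec A (b • (γ₀ : Vec k) + s⁻¹ • w) - applyVec A γ₀) := by abel
  rw [h10]
  have h11 := norm_add_le (applyVec A γ₀ + applyVec G w)
    (applyVec A (b • (γ₀ : Vec k) + s⁻¹ • w) - applyVec A γ₀)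
  rw [quadD_apply] at h2
  rw [quadD_apply]
  linarith

include hG hΓ hne in
/-- The square root of the test statistic is close to the limiting functional. -/
theorem abs_sqrt_phi_sub_le (A : Matrix (Fin m) (Fin k × Fin k) ℝ) {r s : ℝ} (hs : 0 < s)
    (hr : ‖quadD A‖ ≤ r) (hrs : 2 * r / c ≤ s ^ 2) :
    |√(⨅ γ : Sph k, ‖s ^ 2 • applyVec G γ + applyVec A γ‖ ^ 2) - rootDeriv G Γ (quadD A)|
      ≤ statModulus r c s := by
  have : Nonempty (Sph k) := ⟨hne.some⟩
  rw [abs_le]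
  constructor
  · have : rootDeriv G Γ (quadD A) - statModulus r c s
        ≤ √(⨅ γ : Sph k, ‖s ^ 2 • applyVec G γ + applyVec A γ‖ ^ 2) :=
      le_sqrt_iInf_sq_norm fun γ => by
        linarith [rootDeriv_le_stat hG hΓ hne A hs hr γ]
    linarith
  · rw [sub_le_comm]
    refine le_rootDeriv hne fun γ₀ hγ₀ v => ?_
    obtain ⟨γ, hγ⟩ := exists_stat_le hG hΓ A hs hr hrs hγ₀ v
    have := sqrt_iInf_sq_norm_le
      (fun γ : Sph k => s ^ 2 • applyVec G γ + applyVec A γ) γ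
    linarith

variable {G' : Matrix (Fin m) (Fin k × Fin k) ℝ}

theorem norm_applyVec_sub_matrix_le (v : Vec k) :
    ‖applyVec G' v - applyVec G v‖ ≤ ‖quadD (G' - G)‖ * ‖v‖ ^ 2 := by
  have h1 : applyVec G' v - applyVec G v = applyVec (G' - G) v := by
    rw [sub_eq_iff_eq_add, ← applyVec_add_matrix, sub_add_cancel]
  rw [h1]
  exact norm_applyVec_le _ _

/-- The estimated set of minimizers, in terms of the estimated matrix. -/
def minSet (κ : ℝ) (G' : Matrix (Fin m) (Fin k × Fin k) ℝ) : Set (Sph k) :=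
  {γ | ‖applyVec G' γ‖ ^ 2 - (⨅ γ : Sph k, ‖applyVec G' γ‖ ^ 2) ≤ κ ^ 2}

-- On `Γ` the map of `G` vanishes, so that of `G'` is at most `κ`; subtracting a nonnegative infimum
-- keeps the bound.
include hG hΓ in
theorem subset_minSet {κ : ℝ} (hs : ‖quadD (G' - G)‖ ≤ κ) : Γ ⊆ minSet κ G' := by
  intro γ hγ
  have h1 := norm_applyVec_sub_matrix_le (G := G) (G' := G') γ
  rw [hG.applyVec_eq_zero ((hΓ γ).1 hγ), sub_zero, norm_eq_of_mem_sphere γ] at h1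
  have h2 := iInf_sq_norm_nonneg fun γ : Sph k => applyVec G' γ
  have h3 : ‖applyVec G' γ‖ ^ 2 ≤ κ ^ 2 := by
    gcongr
    linarith
  rw [minSet, Set.mem_ofPred_eq]
  linarith

-- A point of `Γ` shows that the infimum is at most `κ²`, so `‖G'γ‖² ≤ 2κ² ≤ (2κ)²`; passing from
-- `G'` to `G` costs another `κ`.
include hG hΓ hne in
theorem norm_le_of_mem_minSet {κ : ℝ} (hκ : 0 ≤ κ) (hs : ‖quadD (G' - G)‖ ≤ κ) {γ : Sph k}
    (hγ : γ ∈ minSet κ G') : ‖applyVec G γ‖ ≤ 3 * κ := by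
  obtain ⟨γ₀, hγ₀⟩ := hne
  have h1 := norm_applyVec_sub_matrix_le (G := G) (G' := G') γ₀
  rw [hG.applyVec_eq_zero ((hΓ γ₀).1 hγ₀), sub_zero, norm_eq_of_mem_sphere γ₀] at h1
  have h2 := ciInf_le (bddBelow_range_sq_norm fun γ : Sph k => applyVec G' γ) γ₀
  have h3 : ‖applyVec G' γ₀‖ ^ 2 ≤ κ ^ 2 := by
    gcongr
    linarith
  have h4 : ‖applyVec G' γ‖ ^ 2 - (⨅ γ : Sph k, ‖applyVec G' γ‖ ^ 2) ≤ κ ^ 2 := hγ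
  have h5 : ‖applyVec G' γ‖ ≤ 2 * κ := by
    refine le_of_sq_le_sq ?_ (by linarith)
    nlinarith
  have h6 := norm_applyVec_sub_matrix_le (G := G) (G' := G') γ
  rw [norm_eq_of_mem_sphere γ, norm_sub_rev] at h6
  have h7 := norm_add_le (applyVec G γ - applyVec G' γ) (applyVec G' γ)
  rw [sub_add_cancel] at h7
  linarith

/-- The radius matches the quadratic dependence on `v`: a matrix error `ηκ` costs at most `η` over
the whole ball. -/
theorem mem_Bset {κ : ℝ} (hκ : 0 < κ) {v : Vec k} : v ∈ Bset k κ ↔ ‖v‖ ^ 2 ≤ κ⁻¹ := by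
  have h1 : κ ^ (-(1 / 2) : ℝ) = √κ⁻¹ := by
    rw [Real.rpow_neg hκ.le, ← Real.sqrt_eq_rpow, Real.sqrt_inv]
  change ‖v‖ ≤ _ ↔ _
  rw [h1, Real.le_sqrt (norm_nonneg _) (by positivity)]

include hG hΓ hne in
/-- The square root of the structural derivative estimator is close to the limiting functional on
bounded sets of quadratic maps. -/
theorem abs_sqrt_derivEstimator_sub_le (A : Matrix (Fin m) (Fin k × Fin k) ℝ) {r κ η : ℝ}
    (hκ : 0 < κ) (hη : 0 ≤ η) (hη1 : η ≤ 1) (hs : ‖quadD (G' - G)‖ ≤ η * κ)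
    (hr : ‖quadD A‖ ≤ r) (hrκ : 2 * r / c ≤ κ⁻¹) :
    |√(⨅ γ : minSet κ G', ⨅ v : Bset k κ,
        ‖quadD A (γ : Sph k) + applyVec G' (v : Vec k)‖ ^ 2) - rootDeriv G Γ (quadD A)|
      ≤ η + 8 * r * √(3 * κ / c) := by
  have hr0 : 0 ≤ r := (norm_nonneg _).trans hr
  have hc := hG.pos
  have hs' : ‖quadD (G' - G)‖ ≤ κ := hs.trans (by nlinarith)
  have hsub := subset_minSet hG hΓ hs'
  have : Nonempty (minSet κ G') := (hne.mono hsub).to_subtype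
  have : Nonempty (Bset k κ) := ⟨0, (mem_Bset hκ).2 (by simp [hκ.le])⟩
  have hdiff : ∀ v ∈ Bset k κ, ‖applyVec G' v - applyVec G v‖ ≤ η := by
    intro v hv
    rw [mem_Bset hκ] at hv
    calc _ ≤ ‖quadD (G' - G)‖ * ‖v‖ ^ 2 := norm_applyVec_sub_matrix_le v
      _ ≤ (η * κ) * κ⁻¹ := by gcongr
      _ = η := by field_simp
  have hK : ∃ x ∈ K, ‖x‖ = 1 := by
    obtain ⟨γ, hγ⟩ := hne
    exact ⟨γ, (hΓ γ).1 hγ, norm_eq_of_mem_sphere γ⟩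
  have hq0 : 0 ≤ 8 * r * √(3 * κ / c) := by positivity
  rw [abs_le]
  constructor
  · have : rootDeriv G Γ (quadD A) - (η + 8 * r * √(3 * κ / c)) ≤
        √(⨅ γ : minSet κ G', ⨅ v : Bset k κ,
          ‖quadD A (γ : Sph k) + applyVec G' (v : Vec k)‖ ^ 2) := by
      refine le_sqrt_iInf_iInf_sq_norm fun γ v => ?_
      -- Lower bound: `γ` moves to a nearby point of `Γ` while `v` is kept; both `A` and the
      -- exchange of `G'` for `G` contribute errors.
      obtain ⟨w, -, h2, γ₀, h3, h4, h5⟩ := hG.exists_near hK (norm_eq_of_mem_sphere γ.1)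
      have h6 := norm_le_of_mem_minSet hG hΓ hne hκ.le hs' γ.2
      have h7 : ‖w‖ ≤ √(3 * κ / c) :=
        Real.le_sqrt_of_sq_le (h2.trans (by gcongr))
      have h8 := rootDeriv_le (G := G) (quadD A) ((hΓ ⟨γ₀, by simpa using h4⟩).2 h3) v
      change _ ≤ ‖applyVec A γ₀ + applyVec G v‖ at h8
      have h9 := norm_applyVec_sub_le A h4 (norm_eq_of_mem_sphere γ.1)
      rw [norm_sub_rev γ₀] at h9
      have h10 : 4 * ‖quadD A‖ * ‖(γ : Vec k) - γ₀‖ ≤ 4 * r * (2 * √(3 * κ / c)) := by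
        gcongr
        linarith
      have h11 := hdiff v v.2
      have h12 : applyVec A γ₀ + applyVec G v
          = (quadD A γ + applyVec G' v) + (applyVec A γ₀ - applyVec A γ)
            - (applyVec G' v - applyVec G v) := by
        rw [quadD_apply]; abel
      have h13 := norm_sub_le ((quadD A γ + applyVec G' v) + (applyVec A γ₀ - applyVec A γ))
        (applyVec G' v - applyVec G v)
      have h14 := norm_add_le (quadD A γ + applyVec G' v) (applyVec A γ₀ - applyVec A γ)
      rw [h12] at h8
      linarith
    linarith
  · rw [sub_le_comm]
    refine le_rootDeriv hne fun γ₀ hγ₀ v => ?_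
    -- Upper bound: `γ₀` is already admissible, and a small `w` replaces `v` so that it lies in the
    -- ball, by `hrκ`.
    obtain ⟨w, -, h1, h2⟩ := hG.exists_small ((norm_apply_le (quadD A) γ₀).trans hr) v
    have hw : w ∈ Bset k κ := (mem_Bset hκ).2 (h1.trans hrκ)
    have h3 := sqrt_iInf_iInf_sq_norm_le
      (fun (γ : minSet κ G') (v : Bset k κ) => quadD A (γ : Sph k) + applyVec G' (v : Vec k))
      ⟨γ₀, hsub hγ₀⟩ ⟨w, hw⟩
    dsimp only at h3
    have h4 := hdiff w hw
    have h5 : quadD A γ₀ + applyVec G' w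
        = (quadD A γ₀ + applyVec G w) + (applyVec G' w - applyVec G w) := by abel
    have h6 := norm_add_le (quadD A γ₀ + applyVec G w) (applyVec G' w - applyVec G w)
    rw [h5] at h3
    linarith

end Comparison

/-! ### Identification in the factor model -/

theorem mulVec_injective_of_rank_eq {a b : ℕ} {A : Matrix (Fin a) (Fin b) ℝ} (h : A.rank = b) :
    Function.Injective A.mulVec := by
  have h1 := A.mulVecLin.finrank_range_add_finrank_ker
  rw [← Matrix.rank, h, Module.finrank_fintype_fun_eq_card, Fintype.card_fin] at h1
  have h2 : LinearMap.ker A.mulVecLin = ⊥ := Submodule.finrank_eq_zero.1 (by omega)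
  exact LinearMap.ker_eq_bot.1 h2

theorem exists_left_inverse_of_rank_eq {a b : ℕ} {A : Matrix (Fin a) (Fin b) ℝ}
    (h : A.rank = b) : ∃ M : Matrix (Fin b) (Fin a) ℝ, M * A = 1 := by
  have h1 : LinearMap.ker A.mulVecLin = ⊥ := LinearMap.ker_eq_bot.2 (mulVec_injective_of_rank_eq h)
  obtain ⟨g, hg⟩ := A.mulVecLin.exists_leftInverse_of_injective h1
  refine ⟨LinearMap.toMatrix' g, ?_⟩
  have h2 := congrArg LinearMap.toMatrix' hg
  rwa [LinearMap.toMatrix'_comp, ← Matrix.toLin'_apply', LinearMap.toMatrix'_toLin',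
    LinearMap.toMatrix'_id] at h2

section Identification

variable {k m p : ℕ}

/-- The squared factor loadings `((γᵀ λ_i)²)_i` of a portfolio. -/
def sqLoadings (L : Matrix (Fin k) (Fin p) ℝ) (v : Vec k) : Fin p → ℝ :=
  fun i => (∑ a, L a i * v a) ^ 2

/-- A matrix of the form of `G` in the factor model separates from the kernel of `Lᵀ`. -/
theorem exists_separatesFrom {G : Matrix (Fin m) (Fin k × Fin k) ℝ}
    (L : Matrix (Fin k) (Fin p) ℝ) {C : Matrix (Fin m) (Fin p) ℝ}
    (hC : Function.Injective C.mulVec)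
    (hG : ∀ v, applyVec G v = WithLp.toLp 2 (C *ᵥ sqLoadings L v)) :
    ∃ (K : Submodule ℝ (Vec k)) (c : ℝ), SeparatesFrom G K c := by
  let ℓ : Vec k →ₗ[ℝ] (Fin p → ℝ) :=
    { toFun := fun v i => ∑ a, L a i * v a
      map_add' := fun u v => by
        funext i; simp [mul_add, Finset.sum_add_distrib]
      map_smul' := fun s v => by
        funext i
        simp only [PiLp.smul_apply, smul_eq_mul, RingHom.id_apply, Pi.smul_apply, Finset.mul_sum]
        exact Finset.sum_congr rfl fun a _ => by ring }
  have hℓ : ∀ v i, sqLoadings L v i = ℓ v i ^ 2 := fun _ _ => rfl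
  have hadd : ∀ x ∈ LinearMap.ker ℓ, ∀ y, applyVec G (x + y) = applyVec G y := by
    intro x hx y
    rw [hG, hG]
    congr 2
    funext i
    rw [hℓ, hℓ, map_add, LinearMap.mem_ker.1 hx, zero_add]
  -- Injectivity of `C` makes all squared loadings vanish, hence the loadings themselves: a
  -- quadratic equation becomes a linear one.
  have hzero : ∀ v, applyVec G v = 0 → v ∈ LinearMap.ker ℓ := by
    intro v hv
    rw [hG] at hv
    have h1 : C *ᵥ sqLoadings L v = C *ᵥ 0 := by
      rw [Matrix.mulVec_zero]
      exact congrArg WithLp.ofLp hv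
    have h2 := hC h1
    rw [LinearMap.mem_ker]
    funext i
    have h3 := congrFun h2 i
    rw [hℓ] at h3
    simpa using h3
  set K := LinearMap.ker ℓ
  -- The growth constant is the minimum over the compact unit sphere of `Kᗮ`, positive because a
  -- zero would lie in `K ∩ Kᗮ`. If that sphere is empty, any positive constant works.
  have hcpt : IsCompact (Metric.sphere (0 : Vec k) 1 ∩ (Kᗮ : Set (Vec k))) :=
    (isCompact_sphere _ _).inter_right Kᗮ.closed_of_finiteDimensional
  have hc : ∃ c : ℝ, 0 < c ∧ ∀ u ∈ Metric.sphere (0 : Vec k) 1 ∩ (Kᗮ : Set (Vec k)),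
      c ≤ ‖applyVec G u‖ := by
    by_cases hne : (Metric.sphere (0 : Vec k) 1 ∩ (Kᗮ : Set (Vec k))).Nonempty
    · obtain ⟨u, hu, hmin⟩ := hcpt.exists_isMinOn hne (continuous_applyVec G).norm.continuousOn
      refine ⟨‖applyVec G u‖, ?_, fun x hx => hmin hx⟩
      rw [norm_pos_iff]
      intro h0
      have h1 : u = 0 := by
        have h2 := hzero u h0
        have h3 := hu.2 u h2
        exact inner_self_eq_zero.1 h3
      have h4 := hu.1
      simp [h1] at h4
    · exact ⟨1, one_pos, fun u hu => absurd ⟨u, hu⟩ hne⟩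
  obtain ⟨c, hc0, hc⟩ := hc
  refine ⟨K, c, hc0, hadd, fun y hy => ?_⟩
  by_cases hy0 : y = 0
  · simp [hy0]
  have hn : ‖y‖ ≠ 0 := norm_ne_zero_iff.2 hy0
  have h1 := hc (‖y‖⁻¹ • y) ⟨by simp [norm_smul, hn], Kᗮ.smul_mem _ hy⟩
  have h2 : y = ‖y‖ • (‖y‖⁻¹ • y) := by rw [smul_smul, mul_inv_cancel₀ hn, one_smul]
  conv_rhs => rw [h2, applyVec_smul, norm_smul, Real.norm_of_nonneg (by positivity)]
  rw [mul_comm]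
  gcongr

end Identification

/-! ### Moments and identification of `G` in the model -/

section Model

variable {Ω : Type*} {mΩ : MeasurableSpace Ω} {P : Measure Ω}
  {k m : ℕ} {Y : ℕ → Ω → Vec k} {Z : ℕ → Ω → Vec m}

theorem memLp_mul_coord (hY : MemLp (Y 1) 4 P) (a b : Fin k) :
    MemLp (fun ω => Y 1 ω a * Y 1 ω b) 2 P := by
  have : (4 : ℝ≥0∞).HolderTriple 4 2 := ⟨by
    rw [← two_mul, show (4 : ℝ≥0∞) = 2 * 2 by norm_num,
      ENNReal.mul_inv (by simp) (by simp), ← mul_assoc,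
      ENNReal.mul_inv_cancel (by simp) (by simp), one_mul]⟩
  exact (hY.eval_piLp b).mul (hY.eval_piLp a)

theorem GPop_apply (j : Fin m) (a b : Fin k) :
    GPop P Y Z j (a, b) = DeltaPop P Y Z j b a := rfl

/-- Since `Matrix.vec` stacks columns, entries of `G` carry swapped indices; symmetry makes this
harmless. -/
theorem DeltaPop_symm (j : Fin m) (a b : Fin k) :
    DeltaPop P Y Z j a b = DeltaPop P Y Z j b a := by
  simp only [DeltaPop, Matrix.of_apply]
  simp only [mul_comm (Y 1 _ a)]

theorem integrable_mul_mul_coord (hY : MemLp (Y 1) 4 P) (hZ : MemLp (Z 0) 2 P) (a b : Fin k)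
    (j : Fin m) : Integrable (fun ω => Z 0 ω j * (Y 1 ω a * Y 1 ω b)) P :=
  (hZ.eval_piLp j).integrable_mul (memLp_mul_coord hY a b)

variable [IsProbabilityMeasure P]

theorem integrable_mul_coord (hY : MemLp (Y 1) 4 P) (a b : Fin k) :
    Integrable (fun ω => Y 1 ω a * Y 1 ω b) P :=
  (memLp_mul_coord hY a b).integrable one_le_two

theorem integrable_coord (hZ : MemLp (Z 0) 2 P) (j : Fin m) : Integrable (fun ω => Z 0 ω j) P :=
  (hZ.eval_piLp j).integrable one_le_two

theorem DeltaPop_apply (hY : MemLp (Y 1) 4 P) (hZ : MemLp (Z 0) 2 P) (j : Fin m)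
    (a b : Fin k) :
    DeltaPop P Y Z j a b = ∫ ω, Z 0 ω j * (Y 1 ω a * Y 1 ω b) ∂P
      - (∫ ω, Z 0 ω j ∂P) * ∫ ω, Y 1 ω a * Y 1 ω b ∂P := by
  simp only [DeltaPop, Matrix.of_apply, mul_sub]
  rw [integral_sub (integrable_mul_mul_coord hY hZ a b j) ((integrable_coord hZ j).mul_const _),
    integral_mul_const]

theorem inner_sq_eq (γ y : Vec k) :
    inner ℝ γ y ^ 2 = ∑ a, ∑ b, γ a * γ b * (y a * y b) := by
  rw [PiLp.inner_apply, pow_two, Finset.sum_mul_sum]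
  refine Finset.sum_congr rfl fun a _ => Finset.sum_congr rfl fun b _ => ?_
  simp only [RCLike.inner_apply, conj_trivial]
  ring

theorem cPop_eq (hY : MemLp (Y 1) 4 P) (γ : Vec k) :
    cPop P Y γ = ∑ a, ∑ b, γ a * γ b * ∫ ω, Y 1 ω a * Y 1 ω b ∂P := by
  simp only [cPop, inner_sq_eq]
  rw [integral_finsetSum _ fun a _ => integrable_finsetSum _ fun b _ =>
    (integrable_mul_coord hY a b).const_mul _]
  refine Finset.sum_congr rfl fun a _ => ?_
  rw [integral_finsetSum _ fun b _ => (integrable_mul_coord hY a b).const_mul _]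
  simp only [integral_const_mul]

/-- The population moment is the quadratic map with matrix `G`. -/
theorem theta0_eq (hY : MemLp (Y 1) 4 P) (hZ : MemLp (Z 0) 2 P) (γ : Sph k) :
    theta0 P Y Z γ = applyVec (GPop P Y Z) γ := by
  have hint : ∀ j, Integrable (fun ω => (inner ℝ (γ : Vec k) (Y 1 ω) ^ 2 - cPop P Y γ) * Z 0 ω j)
      P := by
    intro j
    have h1 : (fun ω => (inner ℝ (γ : Vec k) (Y 1 ω) ^ 2 - cPop P Y γ) * Z 0 ω j)
        = fun ω => (∑ a, ∑ b, (γ : Vec k) a * (γ : Vec k) b * (Z 0 ω j * (Y 1 ω a * Y 1 ω b)))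
          - cPop P Y γ * Z 0 ω j := by
      funext ω
      rw [inner_sq_eq, sub_mul, Finset.sum_mul]
      congr 1
      refine Finset.sum_congr rfl fun a _ => ?_
      rw [Finset.sum_mul]
      exact Finset.sum_congr rfl fun b _ => by ring
    rw [h1]
    exact (integrable_finsetSum _ fun a _ => integrable_finsetSum _ fun b _ =>
      (integrable_mul_mul_coord hY hZ a b j).const_mul _).sub
      ((integrable_coord hZ j).const_mul _)
  ext j
  rw [theta0, eval_integral_piLp (fun j => by simpa using hint j), applyVec_apply]
  have h2 : ∀ a b, Integrable (fun ω => (γ : Vec k) a * (γ : Vec k) b *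
      (Z 0 ω j * (Y 1 ω a * Y 1 ω b - ∫ ω', Y 1 ω' a * Y 1 ω' b ∂P))) P := by
    intro a b
    simp only [mul_sub (Z 0 _ j)]
    exact ((integrable_mul_mul_coord hY hZ a b j).sub
      ((integrable_coord hZ j).mul_const _)).const_mul _
  calc _ = ∫ ω, ∑ a, ∑ b, (γ : Vec k) a * (γ : Vec k) b *
        (Z 0 ω j * (Y 1 ω a * Y 1 ω b - ∫ ω', Y 1 ω' a * Y 1 ω' b ∂P)) ∂P := by
        refine integral_congr_ae (Eventually.of_forall fun ω => ?_)
        simp only [PiLp.smul_apply, smul_eq_mul, inner_sq_eq, cPop_eq hY]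
        rw [← Finset.sum_sub_distrib, Finset.sum_mul]
        refine Finset.sum_congr rfl fun a _ => ?_
        rw [← Finset.sum_sub_distrib, Finset.sum_mul]
        exact Finset.sum_congr rfl fun b _ => by ring
    _ = ∑ a, ∑ b, (γ : Vec k) a * (γ : Vec k) b * DeltaPop P Y Z j a b := by
        rw [integral_finsetSum _ fun a _ => integrable_finsetSum _ fun b _ => h2 a b]
        refine Finset.sum_congr rfl fun a _ => ?_
        rw [integral_finsetSum _ fun b _ => h2 a b]
        simp only [integral_const_mul]
        rfl
    _ = _ := by
        refine Finset.sum_congr rfl fun a _ => Finset.sum_congr rfl fun b _ => ?_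
        rw [GPop_apply, DeltaPop_symm, mul_comm]

variable {p : ℕ} {F : Filtration ℕ mΩ} {σ2 : ℕ → Ω → Fin p → ℝ}
  {L : Matrix (Fin k) (Fin p) ℝ} {Om : Matrix (Fin k) (Fin k) ℝ}

theorem factorVariance_apply (L : Matrix (Fin k) (Fin p) ℝ) (Om : Matrix (Fin k) (Fin k) ℝ)
    (s : Fin p → ℝ) (a b : Fin k) :
    (L * Matrix.diagonal s * Lᵀ + Om) a b = (∑ i, L a i * L b i * s i) + Om a b := by
  rw [Matrix.add_apply, Matrix.mul_apply]
  congr 1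
  refine Finset.sum_congr rfl fun i _ => ?_
  rw [Matrix.mul_diagonal, Matrix.transpose_apply]
  ring

namespace Setup

variable (h : Setup P F Y Z σ2 L Om)
include h

/-- The conditional mean is zero, also coordinatewise because projections commute with conditional
expectation; conditional covariances are thus conditional second moments. -/
theorem condExp_mul_coord (a b : Fin k) :
    P[fun ω => Y 1 ω a * Y 1 ω b | F 0]
      =ᵐ[P] fun ω => (L * Matrix.diagonal (σ2 0 ω) * Lᵀ + Om) a b := by
  have hmean : ∀ a : Fin k, P[fun ω => Y 1 ω a | F 0] =ᵐ[P] 0 := by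
    intro a
    have h1 := ContinuousLinearMap.comp_condExp_comm (m := F 0) (μ := P)
      ((h.moment_Y 1).integrable (by norm_num)) (EuclideanSpace.proj a : Vec k →L[ℝ] ℝ)
    have h2 := h.condMean 0
    filter_upwards [h1, h2] with ω h3 h4
    have h5 : (P[fun ω => Y 1 ω a | F 0]) ω
        = (P[⇑(EuclideanSpace.proj a : Vec k →L[ℝ] ℝ) ∘ Y (0 + 1) | F 0]) ω := rfl
    rw [h5, zero_add, ← h3]
    rw [zero_add] at h4
    simp [h4]
  refine EventuallyEq.trans (condExp_congr_ae ?_) (h.condVar 0 a b)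
  filter_upwards [hmean a, hmean b] with ω h1 h2
  simp only [zero_add]
  rw [h1, h2]
  simp

theorem memLp_condVar (a b : Fin k) :
    MemLp (fun ω => (L * Matrix.diagonal (σ2 0 ω) * Lᵀ + Om) a b) 2 P :=
  ((memLp_mul_coord (h.moment_Y 1) a b).condExp (m := F 0) one_le_two).ae_eq
    (h.condExp_mul_coord a b)

/-- No moments of `σ2` are assumed. A left inverse `M` of `L` recovers `diag(σ2) = M (V - Om) Mᵀ`
from the conditional variance `V`, which is square integrable because `Y` has fourth moments. -/
theorem memLp_σ2 (i : Fin p) : MemLp (fun ω => σ2 0 ω i) 2 P := by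
  obtain ⟨M, hM⟩ := exists_left_inverse_of_rank_eq h.rank_L
  have hM' : Lᵀ * Mᵀ = 1 := by rw [← Matrix.transpose_mul, hM, Matrix.transpose_one]
  have h1 : ∀ ω, σ2 0 ω i
      = ∑ b, (∑ a, M i a * ((L * Matrix.diagonal (σ2 0 ω) * Lᵀ + Om) a b - Om a b)) * M i b := by
    intro ω
    have h2 : M * ((L * Matrix.diagonal (σ2 0 ω) * Lᵀ + Om) - Om) * Mᵀ
        = Matrix.diagonal (σ2 0 ω) := by
      rw [add_sub_cancel_right, Matrix.mul_assoc, Matrix.mul_assoc (L * _), hM', Matrix.mul_one,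
        ← Matrix.mul_assoc, hM, Matrix.one_mul]
    have h3 := congrFun (congrFun h2 i) i
    rw [Matrix.diagonal_apply_eq, Matrix.mul_apply] at h3
    rw [← h3]
    simp only [Matrix.mul_apply, Matrix.transpose_apply, Matrix.sub_apply]
  simp only [h1]
  exact memLp_finsetSum _ fun b _ => (memLp_finsetSum _ fun a _ =>
    ((h.memLp_condVar a b).sub (memLp_const _)).const_mul _).mul_const _

/-- As `Z 0` is known at date zero, the tower property replaces `Y Yᵀ` by its conditional variance.
The constant `Om` drops out of the covariance, leaving the factor part. -/
theorem DeltaPop_eq (j : Fin m) (a b : Fin k) :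
    DeltaPop P Y Z j a b
      = ∑ i, L a i * L b i * cov[fun ω => Z 0 ω j, fun ω => σ2 0 ω i; P] := by
  have hZ := (h.moment_Z 0).eval_piLp j
  have hZm : StronglyMeasurable[F 0] fun ω => Z 0 ω j := by
    have h1 : Measurable[F 0] (Z 0) := h.adapted_Z 0
    exact ((EuclideanSpace.proj j : Vec m →L[ℝ] ℝ).measurable.comp h1).stronglyMeasurable
  have hV := integrable_mul_coord (h.moment_Y 1) a b
  have hZV := integrable_mul_mul_coord (h.moment_Y 1) (h.moment_Z 0) a b j
  have hce := h.condExp_mul_coord a b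
  have e1 : ∫ ω, Y 1 ω a * Y 1 ω b ∂P
      = ∫ ω, (L * Matrix.diagonal (σ2 0 ω) * Lᵀ + Om) a b ∂P := by
    rw [← integral_condExp (F.le 0)]
    exact integral_congr_ae hce
  have e2 : ∫ ω, Z 0 ω j * (Y 1 ω a * Y 1 ω b) ∂P
      = ∫ ω, Z 0 ω j * (L * Matrix.diagonal (σ2 0 ω) * Lᵀ + Om) a b ∂P := by
    rw [← integral_condExp (F.le 0)]
    refine integral_congr_ae ?_
    have h1 := condExp_mul_of_stronglyMeasurable_left hZm hZV hV
    filter_upwards [h1, hce] with ω h2 h3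
    change (P[(fun ω => Z 0 ω j) * (fun ω => Y 1 ω a * Y 1 ω b) | F 0]) ω = _
    rw [h2, Pi.mul_apply, h3]
  rw [DeltaPop_apply (h.moment_Y 1) (h.moment_Z 0), e1, e2]
  have h2 := covariance_eq_sub hZ (h.memLp_condVar a b)
  simp only [Pi.mul_apply] at h2
  rw [← h2]
  have h3 : (fun ω => (L * Matrix.diagonal (σ2 0 ω) * Lᵀ + Om) a b)
      = fun ω => (∑ i, L a i * L b i * σ2 0 ω i) + Om a b :=
    funext fun ω => factorVariance_apply L Om (σ2 0 ω) a b
  rw [h3, covariance_add_const_right, covariance_fun_sum_right]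
  · simp only [covariance_const_mul_right]
  · exact fun i => (h.memLp_σ2 i).const_mul _
  · exact hZ
  · exact integrable_finsetSum _ fun i _ => ((h.memLp_σ2 i).integrable one_le_two).const_mul _

theorem exists_separatesFrom_GPop :
    ∃ (K : Submodule ℝ (Vec k)) (c : ℝ), SeparatesFrom (GPop P Y Z) K c := by
  refine exists_separatesFrom L (mulVec_injective_of_rank_eq (h.cov_Z_σ2 0)) fun v => ?_
  ext j
  simp only [applyVec_apply, GPop_apply, h.DeltaPop_eq, Matrix.mulVec, dotProduct, sqLoadings,
    Matrix.of_apply, pow_two, Finset.sum_mul_sum]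
  simp only [Finset.sum_mul, Finset.mul_sum]
  rw [Finset.sum_congr rfl fun a _ => Finset.sum_comm, Finset.sum_comm]
  refine Finset.sum_congr rfl fun i _ => Finset.sum_congr rfl fun a _ =>
    Finset.sum_congr rfl fun b _ => ?_
  ring

theorem mem_Gamma0_iff {K : Submodule ℝ (Vec k)} {c : ℝ} (hG : SeparatesFrom (GPop P Y Z) K c)
    (γ : Sph k) : γ ∈ Gamma0 P Y Z ↔ (γ : Vec k) ∈ K := by
  rw [← hG.applyVec_eq_zero_iff, ← theta0_eq (h.moment_Y 1) (h.moment_Z 0)]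
  rfl

/-- The infimum is attained by compactness. Positivity of `k` is needed: over an empty sphere the
infimum is zero by convention. -/
theorem Gamma0_nonempty (hk : 0 < k) (h0 : phi (theta0 P Y Z) = 0) : (Gamma0 P Y Z).Nonempty := by
  have : NeZero k := ⟨hk.ne'⟩
  have hne : Nonempty (Sph k) := (NormedSpace.sphere_nonempty.2 zero_le_one).to_subtype
  have hcpt : CompactSpace (Sph k) := inferInstance
  have heq : theta0 P Y Z = fun γ : Sph k => applyVec (GPop P Y Z) γ :=
    funext (theta0_eq (h.moment_Y 1) (h.moment_Z 0))
  have hcont : Continuous fun γ : Sph k => ‖theta0 P Y Z γ‖ ^ 2 := by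
    rw [heq]
    exact (((continuous_applyVec _).comp continuous_subtype_val).norm).pow 2
  obtain ⟨γ, -, hγ⟩ := isCompact_univ.exists_isMinOn Set.univ_nonempty hcont.continuousOn
  refine ⟨γ, ?_⟩
  have h1 : ‖theta0 P Y Z γ‖ ^ 2 ≤ phi (theta0 P Y Z) := le_ciInf fun x => hγ (Set.mem_univ x)
  rw [h0] at h1
  have h2 : ‖theta0 P Y Z γ‖ ^ 2 = 0 := le_antisymm h1 (by positivity)
  have h3 : theta0 P Y Z γ = 0 := by simpa using h2
  exact h3

end Setup

end Model

/-! ### Sample quantities as quadratic maps -/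

section SampleQuadratic

variable {k m T : ℕ}

theorem GHat_apply (x : Sample k m T) (j : Fin m) (a b : Fin k) :
    GHat x j (a, b) = (T : ℝ)⁻¹ * ∑ t, (x t).1 j * ((x t).2 b * (x t).2 a)
      - ((T : ℝ)⁻¹ * ∑ t, (x t).1 j) * ((T : ℝ)⁻¹ * ∑ t, (x t).2 b * (x t).2 a) := rfl

/-- The identity is exact in finite samples, so the statistic and the bootstrap process are governed
by the matrix `GHat` alone. -/
theorem thetaHat_eq (x : Sample k m T) (γ : Sph k) :
    thetaHat x γ = applyVec (GHat x) γ := by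
  have hc : cHat x (γ : Vec k) = ∑ a, ∑ b, ((T : ℝ)⁻¹ * ∑ t, (x t).2 b * (x t).2 a) *
      ((γ : Vec k) a * (γ : Vec k) b) := by
    simp only [cHat, inner_sq_eq, Finset.mul_sum, Finset.sum_mul]
    rw [Finset.sum_comm]
    refine Finset.sum_congr rfl fun a _ => ?_
    rw [Finset.sum_comm]
    exact Finset.sum_congr rfl fun b _ => Finset.sum_congr rfl fun t _ => by ring
  ext j
  have hz : (T : ℝ)⁻¹ * ∑ t, inner ℝ (γ : Vec k) (x t).2 ^ 2 * (x t).1 j =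
      ∑ a, ∑ b, ((T : ℝ)⁻¹ * ∑ t, (x t).1 j * ((x t).2 b * (x t).2 a)) *
        ((γ : Vec k) a * (γ : Vec k) b) := by
    simp only [inner_sq_eq, Finset.mul_sum, Finset.sum_mul]
    rw [Finset.sum_comm]
    refine Finset.sum_congr rfl fun a _ => ?_
    rw [Finset.sum_comm]
    exact Finset.sum_congr rfl fun b _ => Finset.sum_congr rfl fun t _ => by ring
  have hl : thetaHat x γ j = (T : ℝ)⁻¹ * ∑ t, inner ℝ (γ : Vec k) (x t).2 ^ 2 * (x t).1 j
      - ((T : ℝ)⁻¹ * ∑ t, (x t).1 j) * cHat x (γ : Vec k) := by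
    simp only [thetaHat, PiLp.smul_apply, WithLp.ofLp_sum, Finset.sum_apply, smul_eq_mul, sub_mul,
      Finset.sum_sub_distrib, ← Finset.mul_sum]
    ring
  rw [hl, hz, hc, applyVec_apply, Finset.mul_sum, ← Finset.sum_sub_distrib]
  refine Finset.sum_congr rfl fun a _ => ?_
  rw [Finset.mul_sum, ← Finset.sum_sub_distrib]
  refine Finset.sum_congr rfl fun b _ => ?_
  rw [GHat_apply]
  ring

theorem GammaHat_eq (κ : ℝ) (x : Sample k m T) : GammaHat κ x = minSet κ (GHat x) := by
  simp only [GammaHat, minSet, phi, thetaHat_eq]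

theorem phiHat''_eq (κ : ℝ) (x : Sample k m T) (h : Dspace k m) :
    phiHat'' κ x h = ⨅ γ : minSet κ (GHat x), ⨅ v : Bset k κ,
      ‖h (γ : Sph k) + applyVec (GHat x) (v : Vec k)‖ ^ 2 := by
  rw [phiHat'', GammaHat_eq]

theorem bootProc_eq {W : Type*} (R : Resampling k m W) (x : Sample k m T) (w : W) :
    bootProc R T x w = quadD (√(T : ℝ) • (GHat (R T x w) - GHat x)) := by
  have h : ∀ x : Sample k m T, thetaHatD x = quadD (GHat x) := fun x => by
    ext1; funext γ; exact thetaHat_eq x γ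
  rw [bootProc, h, h, map_smul, map_sub]

/-- The fourth root of `T` appears because scaling a vector by `s` scales its quadratic image by
`s²`. -/
theorem stat_eq (x : Sample k m T) (G : Matrix (Fin m) (Fin k × Fin k) ℝ) :
    (T : ℝ) * ⨅ γ : Sph k, ‖thetaHat x γ‖ ^ 2
      = ⨅ γ : Sph k, ‖√(√(T : ℝ)) ^ 2 • applyVec G γ
          + applyVec (√(T : ℝ) • (GHat x - G)) γ‖ ^ 2 := by
  rw [Real.mul_iInf_of_nonneg (Nat.cast_nonneg T)]
  congr 1
  funext γ
  rw [Real.sq_sqrt (Real.sqrt_nonneg _), applyVec_smul_matrix, ← smul_add, ← applyVec_add_matrix,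
    add_sub_cancel, norm_smul, mul_pow, Real.norm_of_nonneg (Real.sqrt_nonneg _),
    Real.sq_sqrt (Nat.cast_nonneg T), thetaHat_eq]

end SampleQuadratic

/-! ### The limiting process as a quadratic map -/

section LimitQuadratic

variable {Ω : Type*} {mΩ : MeasurableSpace Ω} {P : Measure Ω} {k m : ℕ}
  {Y : ℕ → Ω → Vec k} {Z : ℕ → Ω → Vec m}

variable (P Y Z) in
/-- The matrix of the quadratic map `𝔾`, as a linear function of the limit `ξ`. -/
def procMatrix :
    EuclideanSpace ℝ (MomentIndex k m) →ₗ[ℝ] Matrix (Fin m) (Fin k × Fin k) ℝ where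
  toFun ξ := Matrix.of fun j ab => ξ (Sum.inr (Sum.inr ((ab.2, ab.1), j)))
    - (∫ ω, Z 0 ω j ∂P) * ξ (Sum.inr (Sum.inl (ab.2, ab.1)))
    - (∫ ω, Y 1 ω ab.2 * Y 1 ω ab.1 ∂P) * ξ (Sum.inl j)
  map_add' ξ ζ := by
    ext j ab
    simp only [Matrix.of_apply, PiLp.add_apply, Matrix.add_apply]
    ring
  map_smul' s ξ := by
    ext j ab
    simp only [Matrix.of_apply, PiLp.smul_apply, Matrix.smul_apply, smul_eq_mul, RingHom.id_apply]
    ring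

theorem Gproc_eq (ξ : EuclideanSpace ℝ (MomentIndex k m)) :
    Gproc P Y Z ξ = quadD (procMatrix P Y Z ξ) := by
  ext1
  funext γ
  ext j
  rw [quadD_apply, applyVec_apply, Finset.sum_comm]
  change GprocCoord P Y Z ξ (γ : Vec k) j = _
  rw [GprocCoord, Finset.sum_mul, ← Finset.sum_sub_distrib]
  refine Finset.sum_congr rfl fun a _ => ?_
  rw [Finset.sum_mul, ← Finset.sum_sub_distrib]
  refine Finset.sum_congr rfl fun b _ => ?_
  simp only [procMatrix, LinearMap.coe_mk, AddHom.coe_mk, Matrix.of_apply]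
  ring

/-- Linearity on a finite-dimensional space makes continuous functionals of `𝔾` measurable in `ξ`.
-/
theorem continuous_Gproc : Continuous (Gproc P Y Z) := by
  have h : Gproc P Y Z = ⇑(quadD ∘ₗ procMatrix P Y Z) := funext Gproc_eq
  rw [h]
  exact LinearMap.continuous_of_finiteDimensional _

/-- The matrix of the quadratic remainder of the sample moments. -/
def remMatrix (ξ : EuclideanSpace ℝ (MomentIndex k m)) : Matrix (Fin m) (Fin k × Fin k) ℝ :=
  Matrix.of fun j ab => ξ (Sum.inl j) * ξ (Sum.inr (Sum.inl (ab.2, ab.1)))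

theorem continuous_norm_quadD_remMatrix :
    Continuous fun ξ : EuclideanSpace ℝ (MomentIndex k m) => ‖quadD (remMatrix ξ)‖ := by
  have h : Continuous (remMatrix : EuclideanSpace ℝ (MomentIndex k m) → _) := by
    unfold remMatrix
    fun_prop
  exact ((LinearMap.continuous_of_finiteDimensional quadD).comp h).norm

variable (P Y Z) in
/-- The normalized sample mean of the stacked vector. -/
def normalizedMean (T : ℕ) (ω : Ω) : EuclideanSpace ℝ (MomentIndex k m) :=
  √(T : ℝ) • ((T : ℝ)⁻¹ • ∑ t : Fin T, moments (Z t ω) (Y (t + 1) ω)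
      - ∫ ω', moments (Z 0 ω') (Y 1 ω') ∂P)

variable (P Y Z) in
/-- The process `√T {θ̂_T - θ₀}`. -/
def dataProc (T : ℕ) (ω : Ω) : Dspace k m :=
  quadD (√(T : ℝ) • (GHat (sample Y Z T ω) - GPop P Y Z))

/-- Expanding the product of sample means around the expectations leaves one product of two
deviations, each of order `T^{-1/2}`. After normalization it carries the factor `1/√T`. -/
theorem dataProc_eq [IsProbabilityMeasure P] (hY : MemLp (Y 1) 4 P) (hZ : MemLp (Z 0) 2 P)
    {T : ℕ} (hT : 0 < T) (ω : Ω) :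
    dataProc P Y Z T ω = Gproc P Y Z (normalizedMean P Y Z T ω)
      - (√(T : ℝ))⁻¹ • quadD (remMatrix (normalizedMean P Y Z T ω)) := by
  have hs : √(T : ℝ) ≠ 0 := by positivity
  have hint : ∀ i, Integrable (fun ω => moments (Z 0 ω) (Y 1 ω) i) P := by
    rintro (j | ⟨a, b⟩ | ⟨⟨a, b⟩, j⟩)
    · exact integrable_coord hZ j
    · exact integrable_mul_coord hY a b
    · simpa [moments, mul_comm] using integrable_mul_mul_coord hY hZ a b j
  have hS : ∀ i, normalizedMean P Y Z T ω i = √(T : ℝ) * ((T : ℝ)⁻¹ *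
      ∑ t : Fin T, moments (Z t ω) (Y (t + 1) ω) i - ∫ ω', moments (Z 0 ω') (Y 1 ω') i ∂P) := by
    intro i
    simp only [normalizedMean, PiLp.smul_apply, PiLp.sub_apply, smul_eq_mul, WithLp.ofLp_sum,
      Finset.sum_apply]
    rw [eval_integral_piLp hint]
  rw [dataProc, Gproc_eq, ← map_smul, ← map_sub]
  congr 1
  ext j ⟨a, b⟩
  simp only [Matrix.smul_apply, Matrix.sub_apply, smul_eq_mul, GHat_apply, GPop_apply,
    DeltaPop_apply hY hZ, procMatrix, remMatrix, LinearMap.coe_mk, AddHom.coe_mk,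
    Matrix.of_apply, hS, sample]
  simp only [moments, Sum.elim_inl, Sum.elim_inr, mul_comm (Z _ _ j)]
  field_simp
  ring

end LimitQuadratic

/-! ### Upper bounds for laws, from weak convergence -/

section Laws

/-- Tails of a finite measure are small. -/
theorem exists_tail_le {α : Type*} [MeasurableSpace α] (μ : Measure α) [IsFiniteMeasure μ]
    {g : α → ℝ} (hg : Measurable g) {ε : ℝ} (hε : 0 < ε) :
    ∃ r : ℝ, ∀ s, r ≤ s → μ.real {x | s ≤ g x} ≤ ε := by
  have h1 : Tendsto (fun r : ℝ => μ {x | r ≤ g x}) atTop (𝓝 0) := by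
    have h2 := tendsto_measure_iInter_atTop (μ := μ) (s := fun r : ℝ => {x | r ≤ g x})
      (fun r => (measurableSet_le measurable_const hg).nullMeasurableSet)
      (fun r s hrs x (hx : s ≤ g x) => hrs.trans hx) ⟨0, measure_ne_top _ _⟩
    have h3 : ⋂ r : ℝ, {x | r ≤ g x} = ∅ := by
      refine Set.eq_empty_iff_forall_notMem.2 fun x hx => ?_
      have h4 : g x + 1 ≤ g x := Set.mem_iInter.1 hx (g x + 1)
      linarith
    rw [h3, measure_empty] at h2
    exact h2
  have h5 : Tendsto (fun r : ℝ => μ.real {x | r ≤ g x}) atTop (𝓝 0) := by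
    rw [← ENNReal.toReal_zero]
    exact (ENNReal.tendsto_toReal ENNReal.zero_ne_top).comp h1
  exact eventually_atTop.1 (h5.eventually_le_const hε)

/-- Portmanteau for lower level sets of continuous functions. -/
theorem eventually_measureReal_le {Ω E : Type*} [MeasurableSpace Ω] {P : Measure Ω}
    [IsProbabilityMeasure P] [PseudoMetricSpace E] [MeasurableSpace E] [BorelSpace E]
    {ν : Measure E} [IsProbabilityMeasure ν] {X : ℕ → Ω → E}
    (hX : TendstoInDistribution X atTop id (fun _ => P) ν) {u : E → ℝ} (hu : Continuous u)
    (a : ℝ) {ε : ℝ} (hε : 0 < ε) :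
    ∀ᶠ T in atTop, P.real {ω | u (X T ω) ≤ a} ≤ ν.real {x | u x ≤ a} + ε := by
  have hcl : IsClosed {x | u x ≤ a} := isClosed_le hu continuous_const
  have h1 := ProbabilityMeasure.limsup_measure_closed_le_of_tendsto hX.tendsto hcl
  have h2 : ∀ T, (P.map (X T)) {x | u x ≤ a} = P {ω | u (X T ω) ≤ a} := fun T =>
    Measure.map_apply_of_aemeasurable (hX.forall_aemeasurable T) hcl.measurableSet
  simp only [ProbabilityMeasure.coe_mk, Measure.map_id, h2] at h1
  have h3 : limsup (fun T => P {ω | u (X T ω) ≤ a}) atTop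
      < ν {x | u x ≤ a} + ENNReal.ofReal ε :=
    h1.trans_lt (ENNReal.lt_add_right (measure_ne_top _ _) (by simpa using hε))
  filter_upwards [eventually_lt_of_limsup_lt h3] with T hT
  have h4 := ENNReal.toReal_mono (by finiteness) hT.le
  rwa [ENNReal.toReal_add (by finiteness) (by finiteness), ENNReal.toReal_ofReal hε.le] at h4

variable {Ω : Type*} {mΩ : MeasurableSpace Ω} {P : Measure Ω} [IsProbabilityMeasure P]
  {k m : ℕ} {Y : ℕ → Ω → Vec k} {Z : ℕ → Ω → Vec m}
  {ν : Measure (EuclideanSpace ℝ (MomentIndex k m))} [IsGaussian ν]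

/-- The gap between `a` and `b` absorbs the remainder of order `1/√T`. That remainder is tight,
being the image of a convergent sequence under a continuous map. -/
theorem eventually_data_le (hY : MemLp (Y 1) 4 P) (hZ : MemLp (Z 0) 2 P)
    (hclt : FulfillsCLT P Y Z ν) {u : Dspace k m → ℝ} (hu : LipschitzWith 1 u) {a b : ℝ}
    (hab : a < b) {ε : ℝ} (hε : 0 < ε) :
    ∀ᶠ T in atTop, P.real {ω | u (dataProc P Y Z T ω) ≤ a}
      ≤ ν.real {ξ | u (Gproc P Y Z ξ) ≤ b} + ε := by
  have hX : TendstoInDistribution (normalizedMean P Y Z) atTop id (fun _ => P) ν := hclt.tendsto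
  have hrem := continuous_norm_quadD_remMatrix (k := k) (m := m)
  obtain ⟨r, hr⟩ := exists_tail_le ν hrem.measurable (half_pos (half_pos hε))
  have h1 := eventually_measureReal_le hX (hu.continuous.comp (continuous_Gproc (P := P) (Y := Y) (Z := Z))) b
    (half_pos hε)
  -- An upper tail is written as a lower level set of the negated norm, to reuse the same
  -- portmanteau bound.
  have h2 := eventually_measureReal_le hX hrem.neg (-max r 1) (half_pos (half_pos hε))
  have h3 : ∀ᶠ T : ℕ in atTop, max r 1 / (b - a) ≤ √(T : ℝ) :=
    (Real.tendsto_sqrt_atTop.comp tendsto_natCast_atTop_atTop).eventually_ge_atTop _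
  filter_upwards [h1, h2, h3, eventually_gt_atTop 0] with T h4 h5 h6 hT
  have hs : 0 < √(T : ℝ) := by positivity
  have h7 : {ω | u (dataProc P Y Z T ω) ≤ a} ⊆
      {ω | (u ∘ Gproc P Y Z) (normalizedMean P Y Z T ω) ≤ b} ∪
        {ω | -‖quadD (remMatrix (normalizedMean P Y Z T ω))‖ ≤ -max r 1} := by
    intro ω hω
    by_contra hcon
    simp only [Set.mem_union, Set.mem_ofPred_eq, not_or, not_le, Function.comp_apply] at hcon hω
    obtain ⟨h8, h9⟩ := hcon
    have h10 := hu.dist_le_mul (Gproc P Y Z (normalizedMean P Y Z T ω)) (dataProc P Y Z T ω)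
    rw [dataProc_eq hY hZ hT, dist_eq_norm _ (_ - _), sub_sub_cancel, norm_smul,
      Real.norm_of_nonneg (by positivity), Real.dist_eq, ← dataProc_eq hY hZ hT] at h10
    have h11 := le_abs_self (u (Gproc P Y Z (normalizedMean P Y Z T ω)) - u (dataProc P Y Z T ω))
    have h12 : (√(T : ℝ))⁻¹ * ‖quadD (remMatrix (normalizedMean P Y Z T ω))‖ ≤ b - a := by
      rw [inv_mul_le_iff₀ hs]
      rw [div_le_iff₀ (by linarith)] at h6
      linarith
    simp only [NNReal.coe_one, one_mul] at h10
    linarith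
  have h8 : ν.real {ξ | -‖quadD (remMatrix ξ)‖ ≤ -max r 1} ≤ ε / 2 / 2 := by
    simpa only [neg_le_neg_iff] using hr (max r 1) (le_max_left _ _)
  have h9 := measureReal_mono (μ := P) h7
  have h10 := measureReal_union_le (μ := P)
    {ω | (u ∘ Gproc P Y Z) (normalizedMean P Y Z T ω) ≤ b}
    {ω | -‖quadD (remMatrix (normalizedMean P Y Z T ω))‖ ≤ -max r 1}
  simp only [Function.comp_apply, Pi.neg_apply] at h4 h5 h9 h10
  linarith

/-- A ramp: one where `u ≤ a`, zero where `u ≥ b`. -/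
def ramp {E : Type*} (u : E → ℝ) (a b : ℝ) (x : E) : ℝ := max 0 (min 1 ((b - u x) / (b - a)))

theorem ramp_nonneg {E : Type*} (u : E → ℝ) (a b : ℝ) (x : E) : 0 ≤ ramp u a b x :=
  le_max_left _ _

theorem ramp_le_one {E : Type*} (u : E → ℝ) (a b : ℝ) (x : E) : ramp u a b x ≤ 1 :=
  max_le zero_le_one (min_le_left _ _)

theorem one_le_ramp {E : Type*} {u : E → ℝ} {a b : ℝ} (hab : a < b) {x : E} (hx : u x ≤ a) :
    1 ≤ ramp u a b x := by
  refine le_max_of_le_right (le_min le_rfl ?_)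
  rw [one_le_div (by linarith)]
  linarith

theorem ramp_le_indicator {E : Type*} {u : E → ℝ} {a b : ℝ} (hab : a < b) (x : E) :
    ramp u a b x ≤ {x | u x ≤ b}.indicator 1 x := by
  by_cases hx : u x ≤ b
  · rw [Set.indicator_of_mem (by exact hx)]
    exact ramp_le_one u a b x
  · rw [Set.indicator_of_notMem (by exact hx)]
    refine max_le le_rfl (min_le_of_right_le ?_)
    exact div_nonpos_of_nonpos_of_nonneg (by linarith) (by linarith)

theorem abs_ramp_sub_le {E : Type*} [NormedAddCommGroup E] {u : E → ℝ} (hu : LipschitzWith 1 u)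
    {a b : ℝ} (hab : a < b) (x y : E) :
    |ramp u a b x - ramp u a b y| ≤ (b - a)⁻¹ * ‖x - y‖ := by
  have h1 := abs_max_sub_max_le_abs (min 1 ((b - u x) / (b - a))) (min 1 ((b - u y) / (b - a))) 0
  have h2 := abs_min_sub_min_le_max 1 ((b - u x) / (b - a)) 1 ((b - u y) / (b - a))
  rw [max_comm _ 0, max_comm _ 0] at h1
  refine h1.trans (h2.trans ?_)
  have hba : 0 < b - a := by linarith
  rw [sub_self, abs_zero, max_eq_right (abs_nonneg _), ← sub_div, abs_div, abs_of_pos hba,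
    div_eq_inv_mul]
  gcongr
  have h3 := hu.dist_le_mul x y
  rw [NNReal.coe_one, one_mul, Real.dist_eq, dist_eq_norm] at h3
  rwa [sub_sub_sub_cancel_left, abs_sub_comm]

/-- Scaled ramps are bounded Lipschitz functions. -/
theorem smul_ramp_mem_BL1 {E : Type*} [NormedAddCommGroup E] {u : E → ℝ} (hu : LipschitzWith 1 u)
    {a b : ℝ} (hab : a < b) :
    (fun x => (b - a) / (b - a + 1) * ramp u a b x) ∈ BL1 E := by
  have hba : 0 < b - a := by linarith
  -- After scaling, the sup bound `(b-a)/(b-a+1)` and the Lipschitz constant `1/(b-a+1)` add up to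
  -- one.
  refine ⟨(b - a) / (b - a + 1), (b - a) / (b - a + 1) * (b - a)⁻¹, by positivity, ?_, ?_, ?_⟩
  · apply le_of_eq; field_simp
  · intro x
    rw [abs_of_nonneg (mul_nonneg (by positivity) (ramp_nonneg _ _ _ _))]
    exact mul_le_of_le_one_right (by positivity) (ramp_le_one _ _ _ _)
  · intro x y
    rw [← mul_sub, abs_mul, abs_of_nonneg (by positivity), mul_assoc]
    gcongr
    exact abs_ramp_sub_le hu hab x y

variable {W : Type*} [MeasurableSpace W] {Q : Measure W} [IsProbabilityMeasure Q]
  {R : Resampling k m W}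

theorem abs_integral_le_of_mem_BL1 {E α : Type*} [NormedAddCommGroup E] [MeasurableSpace α]
    {μ : Measure α} [IsProbabilityMeasure μ] {f : E → ℝ} (hf : f ∈ BL1 E) (X : α → E) :
    |∫ x, f (X x) ∂μ| ≤ 1 := by
  obtain ⟨a, b, hb, hab, hfa, -⟩ := hf
  have h1 := norm_integral_le_of_norm_le_const (μ := μ) (f := fun x => f (X x)) (C := a)
    (Eventually.of_forall fun x => hfa (X x))
  rw [probReal_univ, mul_one, Real.norm_eq_abs] at h1
  linarith

-- The bound two on the family is essential, since an unbounded real supremum would default to zero.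
omit [IsProbabilityMeasure P] in
theorem abs_sub_le_bootDist {f : Dspace k m → ℝ} (hf : f ∈ BL1 (Dspace k m)) (T : ℕ) (ω : Ω) :
    |∫ w, f (bootProc R T (sample Y Z T ω) w) ∂Q - ∫ ξ, f (Gproc P Y Z ξ) ∂ν|
      ≤ bootDist P Q Y Z ν R T ω := by
  refine le_ciSup (f := fun f : BL1 (Dspace k m) => |∫ w, f.1 (bootProc R T (sample Y Z T ω) w) ∂Q
    - ∫ ξ, f.1 (Gproc P Y Z ξ) ∂ν|) ⟨2, ?_⟩ ⟨f, hf⟩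
  rintro _ ⟨g, rfl⟩
  have h1 := abs_integral_le_of_mem_BL1 (μ := Q) g.2 (bootProc R T (sample Y Z T ω))
  have h2 := abs_integral_le_of_mem_BL1 (μ := ν) g.2 (Gproc P Y Z)
  have h3 := abs_sub (∫ w, g.1 (bootProc R T (sample Y Z T ω) w) ∂Q)
    (∫ ξ, g.1 (Gproc P Y Z ξ) ∂ν)
  dsimp only
  linarith

/-- Conditionally on the data, the law of a Lipschitz functional of the bootstrap process is
bounded above by its limit, up to small errors and with high probability. -/
theorem eventually_boot_le (hboot : BootstrapConsistent P Q Y Z ν R)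
    (hmeas : BootstrapMeasurable P Q Y Z R) {u : Dspace k m → ℝ} (hu : LipschitzWith 1 u)
    {a b : ℝ} (hab : a < b) {η ε : ℝ} (hη : 0 < η) (hε : 0 < ε) :
    ∀ᶠ T in atTop, P.real {ω | ν.real {ξ | u (Gproc P Y Z ξ) ≤ b} + η
      < Q.real {w | u (bootProc R T (sample Y Z T ω) w) ≤ a}} ≤ ε := by
  have hba : 0 < b - a := by linarith
  set l := (b - a) / (b - a + 1) with hl
  have hl0 : 0 < l := by positivity
  have hcont : Continuous (ramp u a b) := by
    have := hu.continuous
    unfold ramp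
    fun_prop
  -- Only the ramp shrunk by `l` is a `BL1` test function, hence the threshold `l * η` for a
  -- discrepancy `η`.
  have h1 := (tendstoInMeasure_iff_measureReal_norm.1 hboot (l * η) (by positivity))
  have h2 := hmeas.weights (ramp u a b) hcont ⟨1, fun h => by
    rw [abs_of_nonneg (ramp_nonneg _ _ _ _)]; exact ramp_le_one _ _ _ _⟩
  filter_upwards [h1.eventually_le_const hε] with T hT
  refine le_trans ?_ hT
  refine ENNReal.toReal_mono (measure_ne_top _ _) (measure_mono_ae ?_)
  filter_upwards [h2 T] with ω hω hlt
  change l * η ≤ ‖bootDist P Q Y Z ν R T ω - 0‖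
  change _ < _ at hlt
  rw [sub_zero]
  refine le_trans ?_ (le_abs_self _)
  have h3 := abs_sub_le_bootDist (P := P) (Q := Q) (Y := Y) (Z := Z) (ν := ν) (R := R)
    (smul_ramp_mem_BL1 hu hab) T ω
  refine le_trans ?_ h3
  refine le_trans ?_ (le_abs_self _)
  rw [integral_const_mul, integral_const_mul, ← mul_sub]
  gcongr
  have hintQ : Integrable (fun w => ramp u a b (bootProc R T (sample Y Z T ω) w)) Q :=
    Integrable.of_bound hω.aestronglyMeasurable 1 (Eventually.of_forall fun w => by
      rw [Real.norm_of_nonneg (ramp_nonneg _ _ _ _)]; exact ramp_le_one _ _ _ _)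
  have hmν : Measurable fun ξ => ramp u a b (Gproc P Y Z ξ) :=
    (hcont.comp continuous_Gproc).measurable
  have hintν : Integrable (fun ξ => ramp u a b (Gproc P Y Z ξ)) ν :=
    Integrable.of_bound hmν.aestronglyMeasurable 1 (Eventually.of_forall fun w => by
      rw [Real.norm_of_nonneg (ramp_nonneg _ _ _ _)]; exact ramp_le_one _ _ _ _)
  have h4 : Q.real {w | u (bootProc R T (sample Y Z T ω) w) ≤ a}
      ≤ ∫ w, ramp u a b (bootProc R T (sample Y Z T ω) w) ∂Q := by
    have h5 := mul_meas_ge_le_integral_of_nonneg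
      (Eventually.of_forall fun w => ramp_nonneg u a b _) hintQ 1
    rw [one_mul] at h5
    exact (measureReal_mono fun w hw => one_le_ramp hab hw).trans h5
  have hms : MeasurableSet {ξ | u (Gproc P Y Z ξ) ≤ b} :=
    measurableSet_le (hu.continuous.comp continuous_Gproc).measurable measurable_const
  have h6 : ∫ ξ, ramp u a b (Gproc P Y Z ξ) ∂ν ≤ ν.real {ξ | u (Gproc P Y Z ξ) ≤ b} := by
    rw [← integral_indicator_one hms]
    refine integral_mono hintν ((integrable_const (1 : ℝ)).indicator hms) fun ξ => ?_
    exact ramp_le_indicator hab (Gproc P Y Z ξ)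
  linarith

end Laws

/-! ### Quantiles of the limiting law -/

section Quantile

variable {Ω : Type*} {mΩ : MeasurableSpace Ω} {P : Measure Ω} {k m : ℕ} {Y : ℕ → Ω → Vec k}
  {Z : ℕ → Ω → Vec m} {ν : Measure (EuclideanSpace ℝ (MomentIndex k m))}

theorem quantile_mem_Icc {H : ℝ → ℝ} (hH : Monotone H) {q a b : ℝ} (ha : H a < q) (hb : q ≤ H b) :
    quantile H q ∈ Set.Icc a b := by
  have hlb : ∀ x ∈ {c | q ≤ H c}, a ≤ x := fun x (hx : q ≤ H x) => by
    by_contra hxa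
    linarith [hH (not_le.1 hxa).le]
  exact ⟨le_csInf ⟨b, hb⟩ hlb, csInf_le ⟨a, hlb⟩ hb⟩

variable (P Y Z) in
/-- The limiting functional, `√φ''`. -/
abbrev rootLimit (h : Dspace k m) : ℝ := rootDeriv (GPop P Y Z) (Gamma0 P Y Z) h

variable (P Y Z ν) in
/-- The cdf of the square root of the limiting variable. -/
def rootCdf (y : ℝ) : ℝ := ν.real {ξ | rootLimit P Y Z (Gproc P Y Z ξ) ≤ y}

theorem limitCdf_eq {x : ℝ} (hx : 0 ≤ x) : limitCdf P Y Z ν x = rootCdf P Y Z ν √x := by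
  rw [limitCdf, rootCdf]
  congr 1
  ext ξ
  exact (Real.sqrt_le_sqrt_iff hx).symm

theorem limitCdf_of_neg {x : ℝ} (hx : x < 0) : limitCdf P Y Z ν x = 0 := by
  have h : {ξ | phi'' P Y Z (Gproc P Y Z ξ) ≤ x} = ∅ := by
    refine Set.eq_empty_iff_forall_notMem.2 fun ξ (hξ : phi'' P Y Z (Gproc P Y Z ξ) ≤ x) => ?_
    have : 0 ≤ phi'' P Y Z (Gproc P Y Z ξ) :=
      Real.iInf_nonneg fun _ => Real.iInf_nonneg fun _ => by positivity
    linarith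
  rw [limitCdf, h, measureReal_empty]

theorem monotone_limitCdf [IsFiniteMeasure ν] : Monotone (limitCdf P Y Z ν) := fun _ _ hxy =>
  measureReal_mono fun _ hξ => le_trans hξ hxy

theorem monotone_rootCdf [IsFiniteMeasure ν] : Monotone (rootCdf P Y Z ν) := fun _ _ hxy =>
  measureReal_mono fun _ hξ => le_trans hξ hxy

theorem exists_le_limitCdf [IsProbabilityMeasure ν] {q : ℝ} (hq : q < 1) :
    ∃ x, q ≤ limitCdf P Y Z ν x := by
  have h1 := tendsto_measure_iUnion_atTop (μ := ν)
    (s := fun x : ℝ => {ξ | phi'' P Y Z (Gproc P Y Z ξ) ≤ x})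
    (fun _ _ hxy _ hξ => le_trans hξ hxy)
  have h2 : ⋃ x : ℝ, {ξ | phi'' P Y Z (Gproc P Y Z ξ) ≤ x} = Set.univ :=
    Set.eq_univ_of_forall fun ξ => Set.mem_iUnion.2 ⟨phi'' P Y Z (Gproc P Y Z ξ),
      show phi'' P Y Z (Gproc P Y Z ξ) ≤ _ from le_rfl⟩
  rw [h2, measure_univ] at h1
  have h3 : Tendsto (limitCdf P Y Z ν) atTop (𝓝 1) := by
    rw [← ENNReal.toReal_one]
    exact (ENNReal.tendsto_toReal ENNReal.one_ne_top).comp h1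
  exact (h3.eventually_const_le hq).exists

/-- Right and left limits at the continuity point give the two inequalities. A quantile at zero is
impossible: the cdf vanishes on the negatives, so continuity would give it the value `0 < q` there.
-/
theorem limitCdf_quantile [IsProbabilityMeasure ν] {q : ℝ} (hq0 : 0 < q) (hq1 : q < 1)
    (hcont : ContinuousAt (limitCdf P Y Z ν) (quantile (limitCdf P Y Z ν) q)) :
    limitCdf P Y Z ν (quantile (limitCdf P Y Z ν) q) = q ∧
      0 < quantile (limitCdf P Y Z ν) q := by
  set H := limitCdf P Y Z ν with hH
  set c := quantile H q with hc
  obtain ⟨x₀, hx₀⟩ : ∃ x, q ≤ H x := exists_le_limitCdf hq1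
  have hnn : ∀ x ∈ {x | q ≤ H x}, 0 ≤ x := fun x (hx : q ≤ H x) => by
    by_contra hneg
    rw [hH, limitCdf_of_neg (not_le.1 hneg)] at hx
    linarith
  have hbdd : BddBelow {x | q ≤ H x} := ⟨0, hnn⟩
  have hc0 : 0 ≤ c := le_csInf ⟨x₀, hx₀⟩ hnn
  have hlt : ∀ x < c, H x < q := fun x hx => not_le.1 fun h => absurd (csInf_le hbdd h) (not_le.2 hx)
  have hgt : ∀ x, c < x → q ≤ H x := fun x hx => by
    obtain ⟨y, hy, hyx⟩ := exists_lt_of_csInf_lt ⟨x₀, hx₀⟩ hx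
    exact le_trans hy (monotone_limitCdf hyx.le)
  have h1 : q ≤ H c :=
    ge_of_tendsto (hcont.tendsto.mono_left nhdsWithin_le_nhds : Tendsto H (𝓝[>] c) _)
      (eventually_mem_nhdsWithin.mono hgt)
  have hleft : Tendsto H (𝓝[<] c) (𝓝 (H c)) := hcont.tendsto.mono_left nhdsWithin_le_nhds
  have h2 : H c ≤ q :=
    le_of_tendsto hleft (eventually_mem_nhdsWithin.mono fun x hx => (hlt x hx).le)
  refine ⟨le_antisymm h2 h1, hc0.lt_of_ne fun h0 => ?_⟩
  have h3 : H c ≤ 0 := le_of_tendsto hleft (eventually_mem_nhdsWithin.mono fun x (hx : x < c) => by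
    rw [hH, limitCdf_of_neg (by linarith)])
  linarith

end Quantile

/-! ### Asymptotics of the test statistic and of the critical value -/

section Asymptotics

variable {Ω : Type*} {mΩ : MeasurableSpace Ω} {P : Measure Ω}
  {k m : ℕ} {Y : ℕ → Ω → Vec k} {Z : ℕ → Ω → Vec m}
  {ν : Measure (EuclideanSpace ℝ (MomentIndex k m))} [IsGaussian ν]
  {K : Submodule ℝ (Vec k)} {c : ℝ}

/-- This is the reason for working with square roots: the squared functional grows quadratically and
is not globally Lipschitz. -/
theorem lipschitzWith_rootLimit (hne : (Gamma0 P Y Z).Nonempty) :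
    LipschitzWith 1 (rootLimit P Y Z) :=
  LipschitzWith.of_le_add fun h h' => by
    have := rootDeriv_sub_le (G := GPop P Y Z) hne h h'
    rw [dist_eq_norm]
    linarith

theorem measureReal_le_one_sub_rootCdf (hne : (Gamma0 P Y Z).Nonempty) {a b : ℝ} (hab : a < b) :
    ν.real {ξ | b ≤ rootLimit P Y Z (Gproc P Y Z ξ)} ≤ 1 - rootCdf P Y Z ν a := by
  have hm : MeasurableSet {ξ | rootLimit P Y Z (Gproc P Y Z ξ) ≤ a} :=
    measurableSet_le
      ((lipschitzWith_rootLimit hne).continuous.comp continuous_Gproc).measurable measurable_const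
  rw [rootCdf, ← probReal_compl_eq_one_sub hm]
  exact measureReal_mono fun ξ (hξ : b ≤ _) (hξ' : _ ≤ a) => by linarith

/-- The process `√T {θ̂_T - θ₀}` is tight. -/
theorem exists_data_tail_le [IsProbabilityMeasure P] (hY : MemLp (Y 1) 4 P) (hZ : MemLp (Z 0) 2 P)
    (hclt : FulfillsCLT P Y Z ν) {ε : ℝ} (hε : 0 < ε) :
    ∃ r : ℝ, 0 ≤ r ∧ ∀ᶠ T in atTop, P.real {ω | r ≤ ‖dataProc P Y Z T ω‖} ≤ ε := by
  obtain ⟨r, hr⟩ := exists_tail_le ν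
    (continuous_Gproc (P := P) (Y := Y) (Z := Z)).norm.measurable (half_pos hε)
  refine ⟨max r 0 + 1, by positivity, ?_⟩
  have h1 := eventually_data_le hY hZ hclt (u := fun h => -‖h‖) lipschitzWith_one_norm.neg
    (a := -(max r 0 + 1)) (b := -max r 0) (by linarith) (half_pos hε)
  filter_upwards [h1] with T hT
  simp only [neg_le_neg_iff] at hT
  linarith [hr (max r 0) (le_max_left _ _)]

variable (hG : SeparatesFrom (GPop P Y Z) K c)
  (hΓ : ∀ γ : Sph k, γ ∈ Gamma0 P Y Z ↔ (γ : Vec k) ∈ K) (hne : (Gamma0 P Y Z).Nonempty)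

include hG hΓ hne in
/-- The square root of the test statistic is asymptotically the limiting functional of
`√T {θ̂_T - θ₀}`. -/
theorem eventually_stat_close {r δ : ℝ} (hδ : 0 < δ) :
    ∀ᶠ T : ℕ in atTop, ∀ ω, ‖dataProc P Y Z T ω‖ ≤ r →
      |√((T : ℝ) * ⨅ γ : Sph k, ‖thetaHat (sample Y Z T ω) γ‖ ^ 2)
        - rootLimit P Y Z (dataProc P Y Z T ω)| ≤ δ := by
  have hT : Tendsto (fun T : ℕ => √(√(T : ℝ))) atTop atTop :=
    Real.tendsto_sqrt_atTop.comp (Real.tendsto_sqrt_atTop.comp tendsto_natCast_atTop_atTop)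
  have h1 : Tendsto (fun T : ℕ => statModulus r c (√(√(T : ℝ)))) atTop (𝓝 0) := by
    have h2 : Tendsto (fun T : ℕ => √(2 * r / c) / √(√(T : ℝ))) atTop (𝓝 0) :=
      hT.const_div_atTop _
    simpa [statModulus] using h2.const_mul (8 * r)
  have h3 : Tendsto (fun T : ℕ => √(√(T : ℝ)) ^ 2) atTop atTop :=
    (tendsto_pow_atTop two_ne_zero).comp hT
  filter_upwards [h1.eventually_le_const hδ, h3.eventually_ge_atTop (2 * r / c),
    hT.eventually_gt_atTop 0] with T h4 h5 h6 ω hω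
  rw [stat_eq (sample Y Z T ω) (GPop P Y Z)]
  exact (abs_sqrt_phi_sub_le hG hΓ hne _ h6 hω h5).trans h4

variable {κ : ℕ → ℝ} {W : Type*} {R : Resampling k m W}

include hG hΓ hne in
/-- The structural derivative estimator is close to the limiting functional at bounded bootstrap
processes. -/
theorem eventually_deriv_close (hκ : Tendsto κ atTop (𝓝[>] 0))
    (hκT : Tendsto (fun T : ℕ => √(T : ℝ) * κ T) atTop atTop) {r s δ : ℝ} (hδ : 0 < δ) :
    ∀ᶠ T : ℕ in atTop, ∀ ω, ‖dataProc P Y Z T ω‖ ≤ r → ∀ w,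
      ‖bootProc R T (sample Y Z T ω) w‖ ≤ s →
      |√(phiHat'' (κ T) (sample Y Z T ω) (bootProc R T (sample Y Z T ω) w))
        - rootLimit P Y Z (bootProc R T (sample Y Z T ω) w)| ≤ δ := by
  set η := min 1 (δ / 2) with hη
  have hη0 : 0 < η := lt_min one_pos (half_pos hδ)
  have hκ0 : Tendsto κ atTop (𝓝 0) := hκ.mono_right nhdsWithin_le_nhds
  have hκpos : ∀ᶠ T in atTop, 0 < κ T := hκ.eventually eventually_mem_nhdsWithin
  have h1 : Tendsto (fun T => 8 * s * √(3 * κ T / c)) atTop (𝓝 0) := by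
    have h2 := ((hκ0.const_mul 3).div_const c).sqrt
    simpa using h2.const_mul (8 * s)
  have h3 : Tendsto (fun T => (κ T)⁻¹) atTop atTop := tendsto_inv_nhdsGT_zero.comp hκ
  filter_upwards [hκpos, h1.eventually_le_const (half_pos hδ), h3.eventually_ge_atTop (2 * s / c),
    hκT.eventually_ge_atTop (r / η), eventually_gt_atTop 0] with T h4 h5 h6 h7 h8 ω hω w hw
  have hT : 0 < √(T : ℝ) := by positivity
  -- Here `√T κ → ∞` enters: the estimation error `r/√T` is eventually below `η κ`.
  have h9 : ‖quadD (GHat (sample Y Z T ω) - GPop P Y Z)‖ ≤ η * κ T := by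
    rw [dataProc, map_smul, norm_smul, Real.norm_of_nonneg hT.le] at hω
    rw [div_le_iff₀ hη0] at h7
    refine le_of_mul_le_mul_left ?_ hT
    linarith
  rw [bootProc_eq] at hw ⊢
  rw [phiHat''_eq]
  refine (abs_sqrt_derivEstimator_sub_le hG hΓ hne _ h4 hη0.le (min_le_left _ _) h9 hw h6).trans ?_
  linarith [min_le_right 1 (δ / 2)]

variable [MeasurableSpace W] {Q : Measure W} [IsProbabilityMeasure Q]

include hG hΓ hne in
/-- The critical value is consistent. -/
theorem eventually_critVal [IsProbabilityMeasure P] (hY : MemLp (Y 1) 4 P) (hZ : MemLp (Z 0) 2 P)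
    (hclt : FulfillsCLT P Y Z ν) (hboot : BootstrapConsistent P Q Y Z ν R)
    (hmeas : BootstrapMeasurable P Q Y Z R) (hκ : Tendsto κ atTop (𝓝[>] 0))
    (hκT : Tendsto (fun T : ℕ => √(T : ℝ) * κ T) atTop atTop) {α y δ ε : ℝ}
    (hδ : 0 < δ) (hδy : δ < y) (hlt : ∀ x < y, rootCdf P Y Z ν x < 1 - α)
    (hgt : ∀ x > y, 1 - α < rootCdf P Y Z ν x) (hε : 0 < ε) :
    ∀ᶠ T : ℕ in atTop, P.real {ω | critVal Q R κ α T (sample Y Z T ω)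
      ∉ Set.Icc ((y - δ) ^ 2) ((y + δ) ^ 2)} ≤ ε := by
  have hlip := lipschitzWith_rootLimit hne
  -- A quarter of the slack at the two nearby points: at most three errors `e` accumulate on either
  -- side, so strict inequalities survive.
  set e := min (1 - α - rootCdf P Y Z ν (y - δ / 3)) (rootCdf P Y Z ν (y + δ / 4) - (1 - α)) / 4
    with he
  have he0 : 0 < e := by
    have h1 := hlt (y - δ / 3) (by linarith)
    have h2 := hgt (y + δ / 4) (by linarith)
    have := lt_min (sub_pos.2 h1) (sub_pos.2 h2)
    positivity
  have he1 : 4 * e ≤ 1 - α - rootCdf P Y Z ν (y - δ / 3) := by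
    have := min_le_left (1 - α - rootCdf P Y Z ν (y - δ / 3))
      (rootCdf P Y Z ν (y + δ / 4) - (1 - α))
    linarith
  have he2 : 4 * e ≤ rootCdf P Y Z ν (y + δ / 4) - (1 - α) := by
    have := min_le_right (1 - α - rootCdf P Y Z ν (y - δ / 3))
      (rootCdf P Y Z ν (y + δ / 4) - (1 - α))
    linarith
  obtain ⟨r, -, hr⟩ := exists_data_tail_le hY hZ hclt (show 0 < ε / 4 by positivity)
  obtain ⟨s, hs⟩ := exists_tail_le ν
    (continuous_Gproc (P := P) (Y := Y) (Z := Z)).norm.measurable he0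
  have hb1 := eventually_boot_le hboot hmeas (u := fun h => -‖h‖) lipschitzWith_one_norm.neg
    (a := -(s + 1)) (b := -s) (by linarith) he0 (show 0 < ε / 4 by positivity)
  have hb2 := eventually_boot_le hboot hmeas hlip
    (a := y - 2 * δ / 3) (b := y - δ / 3) (by linarith) he0 (show 0 < ε / 4 by positivity)
  have hb3 := eventually_boot_le hboot hmeas (u := fun h => -rootLimit P Y Z h) hlip.neg
    (a := -(y + 2 * δ / 3)) (b := -(y + δ / 3)) (by linarith) he0 (show 0 < ε / 4 by positivity)
  have hclose := eventually_deriv_close (R := R) hG hΓ hne hκ hκT (r := r) (s := s + 1)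
    (show 0 < δ / 3 by positivity)
  filter_upwards [hr, hb1, hb2, hb3, hclose] with T h1 h2 h3 h4 h5
  simp only [neg_le_neg_iff] at h2 h4
  set B1 := {ω | r ≤ ‖dataProc P Y Z T ω‖} with hB1
  set B2 := {ω | ν.real {ξ | s ≤ ‖Gproc P Y Z ξ‖} + e
    < Q.real {w | s + 1 ≤ ‖bootProc R T (sample Y Z T ω) w‖}} with hB2
  set B3 := {ω | ν.real {ξ | rootLimit P Y Z (Gproc P Y Z ξ) ≤ y - δ / 3} + e
    < Q.real {w | rootLimit P Y Z (bootProc R T (sample Y Z T ω) w) ≤ y - 2 * δ / 3}} with hB3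
  set B4 := {ω | ν.real {ξ | y + δ / 3 ≤ rootLimit P Y Z (Gproc P Y Z ξ)} + e
    < Q.real {w | y + 2 * δ / 3 ≤ rootLimit P Y Z (bootProc R T (sample Y Z T ω) w)}} with hB4
  have hsub : {ω | critVal Q R κ α T (sample Y Z T ω) ∉ Set.Icc ((y - δ) ^ 2) ((y + δ) ^ 2)}
      ⊆ (B1 ∪ B2) ∪ (B3 ∪ B4) := by
    intro ω hω
    by_contra hcon
    simp only [hB1, hB2, hB3, hB4, Set.mem_union, Set.mem_ofPred_eq, not_or, not_le,
      not_lt] at hcon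
    obtain ⟨⟨g1, g2⟩, g3, g4⟩ := hcon
    refine hω ?_
    set b := bootProc R T (sample Y Z T ω) with hb
    have g5 := h5 ω g1.le
    have g6 := hs s le_rfl
    have hmono : Monotone fun x => Q.real {w | phiHat'' (κ T) (sample Y Z T ω) (b w) ≤ x} :=
      fun _ _ hxy => measureReal_mono fun _ hw => le_trans hw hxy
    refine quantile_mem_Icc hmono ?_ ?_
    -- The margin `δ` is split in thirds: one for the estimator against `rootLimit`, one for the
    -- ramp, and one keeping the cdf away from its value at `y`.
    · have hs1 : {w | phiHat'' (κ T) (sample Y Z T ω) (b w) ≤ (y - δ) ^ 2}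
          ⊆ {w | s + 1 ≤ ‖b w‖} ∪ {w | rootLimit P Y Z (b w) ≤ y - 2 * δ / 3} := by
        intro w hw
        by_cases hbig : s + 1 ≤ ‖b w‖
        · exact Or.inl hbig
        refine Or.inr (show rootLimit P Y Z (b w) ≤ y - 2 * δ / 3 from ?_)
        have h6 := (abs_le.1 (g5 w (not_le.1 hbig).le)).1
        have h7 : √(phiHat'' (κ T) (sample Y Z T ω) (b w)) ≤ y - δ :=
          (Real.sqrt_le_left (by linarith)).2 hw
        linarith
      have h6 := measureReal_mono (μ := Q) hs1
      have h7 := measureReal_union_le (μ := Q) {w | s + 1 ≤ ‖b w‖}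
        {w | rootLimit P Y Z (b w) ≤ y - 2 * δ / 3}
      change Q.real _ < _
      rw [rootCdf] at he1
      linarith
    -- The level set may be nonmeasurable, so its measure is bounded below by covering the whole
    -- space rather than by taking complements.
    · have hs1 : Set.univ ⊆ {w | phiHat'' (κ T) (sample Y Z T ω) (b w) ≤ (y + δ) ^ 2} ∪
          ({w | s + 1 ≤ ‖b w‖} ∪ {w | y + 2 * δ / 3 ≤ rootLimit P Y Z (b w)}) := by
        intro w _
        by_cases hbig : s + 1 ≤ ‖b w‖
        · exact Or.inr (Or.inl hbig)
        by_cases hphi : phiHat'' (κ T) (sample Y Z T ω) (b w) ≤ (y + δ) ^ 2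
        · exact Or.inl hphi
        refine Or.inr (Or.inr (show y + 2 * δ / 3 ≤ rootLimit P Y Z (b w) from ?_))
        have h6 := (abs_le.1 (g5 w (not_le.1 hbig).le)).2
        have h7 : y + δ ≤ √(phiHat'' (κ T) (sample Y Z T ω) (b w)) :=
          Real.le_sqrt_of_sq_le (not_le.1 hphi).le
        linarith
      have h6 := measureReal_mono (μ := Q) hs1
      have h7 := measureReal_union_le (μ := Q)
        {w | phiHat'' (κ T) (sample Y Z T ω) (b w) ≤ (y + δ) ^ 2}
        ({w | s + 1 ≤ ‖b w‖} ∪ {w | y + 2 * δ / 3 ≤ rootLimit P Y Z (b w)})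
      have h8 := measureReal_union_le (μ := Q) {w | s + 1 ≤ ‖b w‖}
        {w | y + 2 * δ / 3 ≤ rootLimit P Y Z (b w)}
      rw [probReal_univ] at h6
      have h9 := measureReal_le_one_sub_rootCdf (ν := ν) hne (show y + δ / 4 < y + δ / 3 by linarith)
      change _ ≤ Q.real _
      linarith
  have h6 := measureReal_mono (μ := P) hsub
  have h7 := measureReal_union_le (μ := P) (B1 ∪ B2) (B3 ∪ B4)
  have h8 := measureReal_union_le (μ := P) B1 B2
  have h9 := measureReal_union_le (μ := P) B3 B4
  linarith

end Asymptotics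

/-! ### Asymptotic size by a sandwich argument -/

section Conclusion

variable {Ω : Type*} {mΩ : MeasurableSpace Ω} {P : Measure Ω} [IsProbabilityMeasure P]
  {k m : ℕ} {Y : ℕ → Ω → Vec k} {Z : ℕ → Ω → Vec m}
  {ν : Measure (EuclideanSpace ℝ (MomentIndex k m))} [IsGaussian ν]
  {K : Submodule ℝ (Vec k)} {c : ℝ}

/-- A test comparing a statistic and a critical value, both nonnegative, which are approximated by
the squares of a functional of `√T {θ̂_T - θ₀}` and of a quantile `y`, has asymptotic size `α`. -/
theorem tendsto_rejection (hY : MemLp (Y 1) 4 P) (hZ : MemLp (Z 0) 2 P)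
    (hclt : FulfillsCLT P Y Z ν) (hne : (Gamma0 P Y Z).Nonempty) {α y : ℝ} (hy : 0 < y)
    (hcont : ContinuousAt (rootCdf P Y Z ν) y) (hval : rootCdf P Y Z ν y = 1 - α)
    {stat crit : ℕ → Ω → ℝ}
    (hstat : ∀ r δ : ℝ, 0 < δ → ∀ᶠ T in atTop, ∀ ω, ‖dataProc P Y Z T ω‖ ≤ r →
      |√(stat T ω) - rootLimit P Y Z (dataProc P Y Z T ω)| ≤ δ)
    (hcrit : ∀ δ ε : ℝ, 0 < δ → δ < y → 0 < ε → ∀ᶠ T in atTop,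
      P.real {ω | crit T ω ∉ Set.Icc ((y - δ) ^ 2) ((y + δ) ^ 2)} ≤ ε) :
    Tendsto (fun T => P.real {ω | crit T ω < stat T ω}) atTop (𝓝 α) := by
  have hlip := lipschitzWith_rootLimit hne
  rw [Metric.tendsto_nhds]
  intro ε hε
  obtain ⟨d, hd, hd'⟩ := Metric.continuousAt_iff.1 hcont (ε / 5) (by positivity)
  -- All shifts, up to `4δ`, stay within the continuity radius `d`, and `y - δ` stays positive so
  -- that squares and roots can be exchanged.
  set δ := min (d / 5) (y / 2) with hδ
  have hδ0 : 0 < δ := lt_min (by positivity) (by positivity)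
  have hδd : 4 * δ < d := by linarith [min_le_left (d / 5) (y / 2)]
  have hδy : δ < y := by linarith [min_le_right (d / 5) (y / 2)]
  have hlow : 1 - α - ε / 5 < rootCdf P Y Z ν (y - 4 * δ) := by
    have h1 := hd' (x := y - 4 * δ) (by
      rw [Real.dist_eq, abs_lt]; constructor <;> linarith)
    rw [hval, Real.dist_eq, abs_lt] at h1
    linarith
  have hupp : rootCdf P Y Z ν (y + 3 * δ) < 1 - α + ε / 5 := by
    have h1 := hd' (x := y + 3 * δ) (by
      rw [Real.dist_eq, abs_lt]; constructor <;> linarith)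
    rw [hval, Real.dist_eq, abs_lt] at h1
    linarith
  have hε5 : 0 < ε / 5 := by positivity
  obtain ⟨r, -, hr⟩ := exists_data_tail_le hY hZ hclt hε5
  have hd1 := eventually_data_le hY hZ hclt hlip
    (a := y + 2 * δ) (b := y + 3 * δ) (by linarith) hε5
  have hd2 := eventually_data_le hY hZ hclt (u := fun h => -rootLimit P Y Z h) hlip.neg
    (a := -(y - 2 * δ)) (b := -(y - 3 * δ)) (by linarith) hε5
  filter_upwards [hr, hd1, hd2, hstat r δ hδ0, hcrit δ (ε / 5) hδ0 hδy hε5] with T h1 h2 h3 h4 h5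
  simp only [neg_le_neg_iff] at h3
  set B1 := {ω | r ≤ ‖dataProc P Y Z T ω‖} with hB1
  set B2 := {ω | crit T ω ∉ Set.Icc ((y - δ) ^ 2) ((y + δ) ^ 2)} with hB2
  set A := {ω | crit T ω < stat T ω} with hA
  have hB := measureReal_union_le (μ := P) B1 B2
  have hgood : ∀ ω, ω ∉ B1 ∪ B2 → |√(stat T ω) - rootLimit P Y Z (dataProc P Y Z T ω)| ≤ δ ∧
      (y - δ) ^ 2 ≤ crit T ω ∧ crit T ω ≤ (y + δ) ^ 2 := by
    intro ω hω
    simp only [Set.mem_union, not_or] at hω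
    have h6 : ‖dataProc P Y Z T ω‖ < r := not_le.1 hω.1
    have h7 : crit T ω ∈ Set.Icc ((y - δ) ^ 2) ((y + δ) ^ 2) := not_not.1 hω.2
    exact ⟨h4 ω h6.le, h7⟩
  have hs1 : A ⊆ {ω | y - 2 * δ ≤ rootLimit P Y Z (dataProc P Y Z T ω)} ∪ (B1 ∪ B2) := by
    intro ω (hω : crit T ω < stat T ω)
    by_cases hb : ω ∈ B1 ∪ B2
    · exact Or.inr hb
    obtain ⟨h6, h7, -⟩ := hgood ω hb
    have h8 : y - δ ≤ √(stat T ω) := Real.le_sqrt_of_sq_le (by linarith)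
    refine Or.inl (show y - 2 * δ ≤ rootLimit P Y Z (dataProc P Y Z T ω) from ?_)
    linarith [(abs_le.1 h6).2]
  -- Again a cover of the whole space gives the lower bound on the outer probability of rejection.
  have hs2 : Set.univ ⊆ A ∪
      ({ω | rootLimit P Y Z (dataProc P Y Z T ω) ≤ y + 2 * δ} ∪ (B1 ∪ B2)) := by
    intro ω _
    by_cases hω : crit T ω < stat T ω
    · exact Or.inl hω
    by_cases hb : ω ∈ B1 ∪ B2
    · exact Or.inr (Or.inr hb)
    obtain ⟨h6, -, h7⟩ := hgood ω hb
    have h8 : √(stat T ω) ≤ y + δ := by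
      rw [Real.sqrt_le_left (by linarith)]
      linarith
    refine Or.inr (Or.inl (show rootLimit P Y Z (dataProc P Y Z T ω) ≤ y + 2 * δ from ?_))
    linarith [(abs_le.1 h6).1]
  have h6 := measureReal_mono (μ := P) hs1
  have h7 := measureReal_union_le (μ := P)
    {ω | y - 2 * δ ≤ rootLimit P Y Z (dataProc P Y Z T ω)} (B1 ∪ B2)
  have h8 := measureReal_mono (μ := P) hs2
  have h9 := measureReal_union_le (μ := P) A
    ({ω | rootLimit P Y Z (dataProc P Y Z T ω) ≤ y + 2 * δ} ∪ (B1 ∪ B2))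
  have h10 := measureReal_union_le (μ := P)
    {ω | rootLimit P Y Z (dataProc P Y Z T ω) ≤ y + 2 * δ} (B1 ∪ B2)
  have h11 := measureReal_le_one_sub_rootCdf (ν := ν) hne
    (show y - 4 * δ < y - 3 * δ by linarith)
  rw [probReal_univ] at h8
  rw [rootCdf] at hupp
  rw [Real.dist_eq, abs_lt]
  constructor <;> linarith

end Conclusion

end CommonCH

end

theorem proposition4p2
    {Ω : Type*} [mΩ : MeasurableSpace Ω] (P : Measure Ω) [IsProbabilityMeasure P]
    {W : Type*} [MeasurableSpace W] (Q : Measure W) [IsProbabilityMeasure Q]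
    {k m p : ℕ} (hk : 0 < k)
    (F : Filtration ℕ mΩ)
    (Y : ℕ → Ω → CommonCH.Vec k) (Z : ℕ → Ω → CommonCH.Vec m) (σ2 : ℕ → Ω → Fin p → ℝ)
    (L : Matrix (Fin k) (Fin p) ℝ) (Om : Matrix (Fin k) (Fin k) ℝ)
    (hsetup : CommonCH.Setup P F Y Z σ2 L Om)
    (ν : Measure (EuclideanSpace ℝ (CommonCH.MomentIndex k m))) [IsGaussian ν]
    (hclt : CommonCH.FulfillsCLT P Y Z ν)
    (R : CommonCH.Resampling k m W)
    (hboot : CommonCH.BootstrapConsistent P Q Y Z ν R)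
    (hmeas : CommonCH.BootstrapMeasurable P Q Y Z R)
    (κ : ℕ → ℝ) (hκ : Tendsto κ atTop (𝓝[>] 0))
    (hκT : Tendsto (fun T : ℕ => √(T : ℝ) * κ T) atTop atTop)
    (α : ℝ) (hα : α ∈ Set.Ioo (0 : ℝ) 1)
    (hcont : ContinuousAt (CommonCH.limitCdf P Y Z ν)
      (CommonCH.quantile (CommonCH.limitCdf P Y Z ν) (1 - α)))
    (hincr : CommonCH.StrictlyIncreasingAt (CommonCH.limitCdf P Y Z ν)
      (CommonCH.quantile (CommonCH.limitCdf P Y Z ν) (1 - α)))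
    (hnull : CommonCH.phi (CommonCH.theta0 P Y Z) = 0) :
    Tendsto (fun T : ℕ => P.real {ω |
        CommonCH.critVal Q R κ α T (CommonCH.sample Y Z T ω)
          < (T : ℝ) * ⨅ γ : CommonCH.Sph k, ‖CommonCH.thetaHat (CommonCH.sample Y Z T ω) γ‖ ^ 2})
      atTop (𝓝 α) := by
  have hY := hsetup.moment_Y 1
  have hZ := hsetup.moment_Z 0
  obtain ⟨K, c, hG⟩ := hsetup.exists_separatesFrom_GPop
  have hΓ := hsetup.mem_Gamma0_iff hG
  have hne := hsetup.Gamma0_nonempty hk hnull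
  obtain ⟨hval, hpos⟩ := CommonCH.limitCdf_quantile (by linarith [hα.2]) (by linarith [hα.1]) hcont
  set q := CommonCH.quantile (CommonCH.limitCdf P Y Z ν) (1 - α) with hq
  have hy : 0 < √q := Real.sqrt_pos.2 hpos
  have hsq : √q ^ 2 = q := Real.sq_sqrt hpos.le
  have hroot : ∀ x, 0 ≤ x → CommonCH.rootCdf P Y Z ν x = CommonCH.limitCdf P Y Z ν (x ^ 2) :=
    fun x hx => by rw [CommonCH.limitCdf_eq (by positivity), Real.sqrt_sq hx]
  have hval' : CommonCH.rootCdf P Y Z ν √q = 1 - α := by rw [hroot _ hy.le, hsq, hval]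
  have hcont' : ContinuousAt (CommonCH.rootCdf P Y Z ν) √q := by
    have h1 : ContinuousAt (fun x => CommonCH.limitCdf P Y Z ν (x ^ 2)) √q :=
      ContinuousAt.comp (f := fun x : ℝ => x ^ 2) (g := CommonCH.limitCdf P Y Z ν)
        (by rwa [hsq]) (by fun_prop)
    refine h1.congr ?_
    filter_upwards [lt_mem_nhds hy] with x hx
    exact (hroot x (le_of_lt hx)).symm
  have hlt : ∀ x < √q, CommonCH.rootCdf P Y Z ν x < 1 - α := by
    intro x hx
    -- Truncation at zero handles negative `x`, where the cdf of the root is not the limiting cdf at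
    -- `x²`.
    refine (CommonCH.monotone_rootCdf (le_max_left x 0)).trans_lt ?_
    rw [hroot _ (le_max_right x 0), ← hval]
    refine hincr.1 _ ?_
    rw [← hsq]
    have := max_lt hx hy
    gcongr
  have hgt : ∀ x > √q, 1 - α < CommonCH.rootCdf P Y Z ν x := by
    intro x hx
    rw [hroot _ (hy.le.trans (le_of_lt hx)), ← hval]
    refine hincr.2 _ ?_
    rw [gt_iff_lt, ← hsq]
    gcongr
  exact CommonCH.tendsto_rejection hY hZ hclt hne hy hcont' hval'
    (fun _ _ hδ => CommonCH.eventually_stat_close hG hΓ hne hδ)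
    (fun _ _ hδ hδy hε => CommonCH.eventually_critVal hG hΓ hne hY hZ hclt hboot hmeas hκ hκT hδ hδy
      hlt hgt hε)
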